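/- Let $\mathcal H_S$ be a complex Hilbert space, $H$ a self-adjoint operator on it, and $(L_\alpha)_{\alpha}$ a finite family of bounded operators; put $M_\alpha=L_\alpha+I$. Let $(N_\alpha)_\alpha$ be independent standard (rate one) Poisson processes relative to a filtration $(\mathcal F_t)_{t\ge0}$ of a probability space (the increments over $(s,t]$ of the whole family being independent of $\mathcal F_s$), and let $d\widetilde N_\alpha=dN_\alpha-dt$. Let $\psi_t$ be a càdlàg adapted $\mathcal H_S$-valued solution of $$d\psi_t=\Big(\sum_\alpha L_\alpha\,d\widetilde N_\alpha-\big(iH+\tfrac12\sum_\alpha L_\alpha^\dagger L_\alpha\big)dt\Big)\psi_t,\qquad \psi_0=\varphi_0,\quad \|\varphi_0\|=1,$$ that is, of the corresponding integral equation, in which the integrals against $\widetilde N_\alpha$ are pathwise with integrand evaluated at the left limit $\psi_{s-}$, and in which (if $H$ is unbounded) $\psi_s$ lies in the domain of $H$ for almost every $s$ and $H\psi_s$ is locally integrable. Let $\Psi_t=\Phi_t\psi_t$ be the normalized state, where $\Phi_t$ is any scalar process such that, almost surely, $\Phi_t^*\Phi_t=\langle\psi_t|\psi_t\rangle^{-1}$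 for all $t$ with $\psi_t\ne0$ (so $\Psi_t=0$ when $\psi_t=0$). For real processes $f_\alpha$, a Doléans-Dade exponential $\mathcal E(X)$ of $X_t=\sum_\alpha\int_0^t f_\alpha\,d\widetilde N_\alpha$ is a càdlàg adapted process $Z$ with $Z_t=1+\sum_\alpha\int_0^t Z_{s-}f_\alpha(s)\,d\widetilde N_\alpha(s)$ for all $t$, almost surely (the $f_\alpha$ and $Z_{s-}f_\alpha(s)$ being locally integrable in time, almost surely). Then, almost surely, $(\|M_\alpha\Psi_s\|-1)^2$ is locally integrable in $s$ for every $\alpha$; the Doléans-Dade exponential of $\sum_\alpha\int_0^t(\|M_\alpha\Psi_s\|-1)\,d\widetilde N_\alpha$ (with $\|M_\alpha\Psi_s\|$ replaced by its left limit at $s$ in the integrand) exists; and for every version of it, almost surely, for all $t\ge0$, the square root $\phi_t$ of the norm-squared process $\langle\psi_t|\psi_t\rangle$ is $$\phi_t=\exp\Big(-\frac12\sum_\alpha\int_0^t\big(\|M_\alpha\Psi_s\|-1\big)^2ds\Big)\;\mathcal E\Big(\sum_\alpha\int_0^t\big(\|M_\alpha\Psi_s\|-1\big)\,d\widetilde N_\alpha\Big).$$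 -/

import Mathlib

open MeasureTheory ProbabilityTheory Filter Set
open scoped NNReal Topology

noncomputable section

/-- A path is càdlàg: right-continuous with left limits. -/
def IsCadlag {F : Type*} [TopologicalSpace F] (x : ℝ≥0 → F) : Prop :=
  ∀ t, ContinuousWithinAt x (Ici t) t ∧ ∃ l, Tendsto x (𝓝[<] t) (𝓝 l)

/-- The jump `Δn_s = n_s - n_{s-}` of a counting path at time `s`. -/
def jumpSize (n : ℝ≥0 → ℕ) (s : ℝ≥0) : ℕ := n s - Function.leftLim n s

/-- The pathwise (Lebesgue–Stieltjes) integral `∫_{(0,t]} g_s dñ_s` of a path `g` against a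
compensated counting path `dñ_s = dn_s - ds`, that is
`∑_{0 < s ≤ t} Δn_s g_s - ∫_0^t g_s ds`. The sum has finitely many nonzero terms whenever `n` is
nondecreasing. Integrands which are left limits have to be passed as left limits. -/
def compensatedIntegral {F : Type*} [NormedAddCommGroup F] [NormedSpace ℝ F]
    (n : ℝ≥0 → ℕ) (g : ℝ≥0 → F) (t : ℝ≥0) : F :=
  (∑ᶠ (s : ℝ≥0) (_ : s ∈ Ioc 0 t), jumpSize n s • g s) - ∫ s in (0 : ℝ)..t, g s.toNNReal

/-- `N` is a finite family of independent standard (rate one) Poisson processes relative to the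
filtration `𝓕`: adapted counting processes started at `0`, with Poisson increments of mean `t - s`
that are independent of the past `𝓕 s`, the processes `N α` being independent of each other. -/
structure IsPoissonFamily {Ω ι : Type*} {mΩ : MeasurableSpace Ω} (𝓕 : Filtration ℝ≥0 mΩ)
    (P : Measure Ω) (N : ι → ℝ≥0 → Ω → ℕ) : Prop where
  adapted : ∀ α, Adapted 𝓕 (N α)
  zero : ∀ α ω, N α 0 ω = 0
  mono : ∀ α ω, Monotone fun t => N α t ω
  right_continuous : ∀ α ω t, ContinuousWithinAt (fun s => N α s ω) (Ici t) t
  increment_law : ∀ α s t, s ≤ t →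
    HasLaw (fun ω => N α t ω - N α s ω) (poissonMeasure (t - s)) P
  increment_indep : ∀ s t, s ≤ t →
    Indep (𝓕 s) (MeasurableSpace.comap (fun ω α => N α t ω - N α s ω) inferInstance) P
  indep : iIndepFun (fun α ω t => N α t ω) P

variable {E : Type*} [NormedAddCommGroup E] [InnerProductSpace ℂ E] [CompleteSpace E]

open Classical in
/-- The value `H x` of a (possibly unbounded) operator at a vector of its domain, and `0` at
vectors outside the domain. -/
def opValue (H : E →ₗ.[ℂ] E) (x : E) : E := if h : x ∈ H.domain then H ⟨x, h⟩ else 0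

/-- `ψ` is a càdlàg adapted (strong) solution, with initial value `φ₀`, of the linear stochastic
Schrödinger equation
`dψ_t = (∑_α L_α dÑ_α - (i H + (1/2) ∑_α L_α† L_α) dt) ψ_t`, read as a stochastic integral
equation. The solution takes values in the domain of `H` for almost every time. -/
structure IsLinearSolution {Ω ι : Type*} [Fintype ι] {mΩ : MeasurableSpace Ω}
    (𝓕 : Filtration ℝ≥0 mΩ) (P : Measure Ω) (N : ι → ℝ≥0 → Ω → ℕ)
    (H : E →ₗ.[ℂ] E) (L : ι → E →L[ℂ] E) (φ₀ : E) (ψ : ℝ≥0 → Ω → E) : Prop where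
  adapted : StronglyAdapted 𝓕 ψ
  cadlag : ∀ ω, IsCadlag fun t => ψ t ω
  mem_domain : ∀ᵐ ω ∂P, ∀ᵐ s : ℝ ∂volume, 0 ≤ s → ψ s.toNNReal ω ∈ H.domain
  integrable : ∀ᵐ ω ∂P, ∀ t : ℝ≥0,
    IntervalIntegrable (fun s : ℝ => opValue H (ψ s.toNNReal ω)) volume 0 t
  equation : ∀ᵐ ω ∂P, ∀ t : ℝ≥0,
    ψ t ω = φ₀
      + ∑ α, compensatedIntegral (fun s => N α s ω)
          (fun s => L α (Function.leftLim (fun r => ψ r ω) s)) t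
      - ∫ s in (0 : ℝ)..t, (Complex.I • opValue H (ψ s.toNNReal ω)
          + (1 / 2 : ℂ) • ∑ α, (L α).adjoint (L α (ψ s.toNNReal ω)))

/-- `Z` is the Doléans-Dade exponential `𝓔(X)` of `X_t = ∑_α ∫_0^t f_α(s) dÑ_α(s)`, that is, the
càdlàg adapted solution of `dZ_t = Z_{t-} dX_t`, `Z_0 = 1`. -/
structure IsDoleansDadeExp {Ω ι : Type*} [Fintype ι] {mΩ : MeasurableSpace Ω}
    (𝓕 : Filtration ℝ≥0 mΩ) (P : Measure Ω) (N : ι → ℝ≥0 → Ω → ℕ)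
    (f : ι → ℝ≥0 → Ω → ℝ) (Z : ℝ≥0 → Ω → ℝ) : Prop where
  adapted : StronglyAdapted 𝓕 Z
  cadlag : ∀ ω, IsCadlag fun t => Z t ω
  integrable_driver : ∀ᵐ ω ∂P, ∀ (α : ι) (t : ℝ≥0),
    IntervalIntegrable (fun s : ℝ => f α s.toNNReal ω) volume 0 t
  integrable : ∀ᵐ ω ∂P, ∀ (α : ι) (t : ℝ≥0),
    IntervalIntegrable
      (fun s : ℝ => Function.leftLim (fun r => Z r ω) s.toNNReal * f α s.toNNReal ω) volume 0 t
  equation : ∀ᵐ ω ∂P, ∀ t : ℝ≥0,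
    Z t ω = 1 + ∑ α, compensatedIntegral (fun s => N α s ω)
      (fun s => Function.leftLim (fun r => Z r ω) s * f α s ω) t

end

/-! ### Continuous induction on the half line -/

/-! The argument is pathwise. Almost surely the counting paths jump by one and never simultaneously
(`ae_jumpSize_cases`), so a jump of `N α` turns `ψ` into `ψ + L α ψ = M α ψ`. Between jumps the term
with `H` does not affect the norm, and the remaining drift gives `d‖ψ‖² = -∑ (‖M α ψ‖² - ‖ψ‖²) dt`
(`isJumpFlow_of_equation`). Since `H` may be unbounded, `ψ` is only absolutely continuous there, and
the product rule for `‖ψ‖²` is proved by hand in `norm_sq_eq_sub_integral`.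

Let `r α = ‖M α ψ‖ / ‖ψ‖`, which is `‖M α Ψ‖`. From `r² - 1 = (r - 1)² + 2 (r - 1)`, the logarithmic
derivative of `‖ψ‖` between jumps is `-½ ∑ (r α - 1)² - ∑ (r α - 1)`. Multiplying `‖ψ‖` by `exp (½ ∑
∫ (r α - 1)² ds)` removes the squares. The product, `densityPath`, has drift `-∑ (r α - 1)` and is
multiplied by `r α` at a jump, which is the Doléans-Dade equation (`evolvesBy_densityPath`). Its
coefficients are bounded by `‖M α‖ + 1`, so a Grönwall argument makes the solution unique
(`EvolvesBy.doleansDade_unique`), and every version equals `densityPath`.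

The ratio is discontinuous at `ψ = 0`. A path at zero stays there for a while, and one off zero
stays off for a while, so right germs fall into two easy cases; at a jump from a zero left limit the
ratio is multiplied by zero.

Jump times are never enumerated: integral equations are replaced by a left-limit rule and a
right-germ rule (`EvolvesBy`), and global statements follow by continuous induction. -/

theorem NNReal.continuous_induction {p : ℝ≥0 → Prop}
    (left : ∀ t, (∀ s < t, p s) → p t)
    (right : ∀ t, (∀ s ≤ t, p s) → ∀ᶠ s in 𝓝[>] t, p s) (t : ℝ≥0) : p t := by
  by_contra hpt
  set S : Set ℝ≥0 := {s | ¬ p s} with hS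
  have hne : S.Nonempty := ⟨t, hpt⟩
  set a := sInf S with ha
  have hlt : ∀ s < a, p s := fun s hs => by
    by_contra h
    exact absurd (csInf_le (OrderBot.bddBelow S) h) (not_le.2 hs)
  have hpa : p a := left a hlt
  have hle : ∀ s ≤ a, p s := fun s hs => hs.lt_or_eq.elim (hlt s) (fun h => h ▸ hpa)
  obtain ⟨b, hab, hb⟩ := (mem_nhdsGT_iff_exists_Ioo_subset).1 (right a hle)
  have : b ≤ a := le_csInf hne fun s hs => by
    by_contra! hsb
    rcases le_or_gt s a with h | h
    · exact hs (hle s h)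
    · exact hs (hb ⟨h, hsb⟩)
  exact absurd hab (not_lt.2 this)

theorem NNReal.neBot_nhdsLT {t : ℝ≥0} (ht : 0 < t) : (𝓝[<] t).NeBot :=
  nhdsLT_neBot_of_exists_lt ⟨0, ht⟩

/-- Every failure point is isolated from the right in the set of failures, and a set has only
countably many such points. This later lets left limits be replaced by values under Lebesgue
integrals. -/
theorem NNReal.countable_of_eventually_nhdsGT {p : ℝ≥0 → Prop}
    (h : ∀ t, ∀ᶠ u in 𝓝[>] t, p u) : {t | ¬ p t}.Countable := by
  have hc := countable_setOfPred_isolated_right_within (s := {t | ¬ p t})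
  refine hc.mono fun t ht => mem_ofPred_eq ▸ ⟨ht, ?_⟩
  rw [← empty_mem_iff_bot, inter_comm, nhdsWithin_inter', mem_inf_principal]
  filter_upwards [h t] with u hu hu'
  exact hu' hu

theorem NNReal.ae_toNNReal_of_countable {p : ℝ≥0 → Prop} (h : {t | ¬ p t}.Countable) :
    ∀ᵐ s : ℝ ∂volume, 0 ≤ s → p s.toNNReal := by
  have : (((↑) : ℝ≥0 → ℝ) '' {t | ¬ p t}).Countable := h.image _
  filter_upwards [this.ae_notMem volume] with s hs h0
  by_contra hp
  exact hs ⟨s.toNNReal, hp, Real.coe_toNNReal s h0⟩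

theorem NNReal.ae_toNNReal_of_eventually_nhdsGT {p : ℝ≥0 → Prop}
    (h : ∀ t, ∀ᶠ u in 𝓝[>] t, p u) : ∀ᵐ s : ℝ ∂volume, 0 ≤ s → p s.toNNReal :=
  NNReal.ae_toNNReal_of_countable (NNReal.countable_of_eventually_nhdsGT h)

/-! ### Counting paths -/

/-- A counting path: a nondecreasing right-continuous path with values in `ℕ`. -/
structure IsCountingPath (n : ℝ≥0 → ℕ) : Prop where
  mono : Monotone n
  right_continuous : ∀ t, ContinuousWithinAt n (Ici t) t

namespace IsCountingPath

variable {n : ℝ≥0 → ℕ}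

theorem jumpSize_eq_zero_of_eventuallyEq {s : ℝ≥0} (h : ∀ᶠ r in 𝓝[<] s, n r = n s)
    : jumpSize n s = 0 := by
  rcases eq_or_ne (𝓝[<] s) ⊥ with h' | h'
  · simp [jumpSize, leftLim_eq_of_eq_bot n h']
  · have : NeBot (𝓝[<] s) := ⟨h'⟩
    have ht : Tendsto n (𝓝[<] s) (𝓝 (n s)) := tendsto_const_nhds.congr' (h.mono fun r hr => hr.symm)
    rw [jumpSize, leftLim_eq_of_tendsto ht, Nat.sub_self]

/-- Values are discrete, so right continuity makes the path constant just after `t`. The left-hand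
analogue uses that the left limit is attained, and must leave out `t` itself. -/
theorem eventually_right (hn : IsCountingPath n) (t : ℝ≥0) :
    ∀ᶠ u in 𝓝[>] t, ∀ s ∈ Ioc t u, jumpSize n s = 0 := by
  have h : ∀ᶠ u in 𝓝[>] t, n u = n t := by
    have := ((hn.right_continuous t).mono Ioi_subset_Ici_self).tendsto
    rw [nhds_discrete, tendsto_pure] at this
    exact this
  filter_upwards [h] with u hu s hs
  apply jumpSize_eq_zero_of_eventuallyEq
  filter_upwards [Ioo_mem_nhdsLT hs.1] with r hr
  have h1 := hn.mono hr.1.le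
  have h2 := hn.mono hr.2.le
  have h3 := hn.mono hs.2
  omega

theorem eventually_left (hn : IsCountingPath n) {t : ℝ≥0} (ht : 0 < t) :
    ∀ᶠ r in 𝓝[<] t, ∀ s ∈ Ioo r t, jumpSize n s = 0 := by
  have := NNReal.neBot_nhdsLT ht
  have h : ∀ᶠ u in 𝓝[<] t, n u = Function.leftLim n t := by
    have := hn.mono.tendsto_leftLim t
    rw [nhds_discrete, tendsto_pure] at this
    exact this
  filter_upwards [h] with u hu s hs
  apply jumpSize_eq_zero_of_eventuallyEq
  filter_upwards [Ioo_mem_nhdsLT hs.1] with r hr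
  have h1 := hn.mono hr.1.le
  have h2 := hn.mono hr.2.le
  have h3 := hn.mono.le_leftLim hs.2
  omega

/-- Jump times accumulate from neither side, so finiteness propagates by continuous induction. -/
theorem finite_jumps (hn : IsCountingPath n) (t : ℝ≥0) :
    {s ∈ Ioc 0 t | jumpSize n s ≠ 0}.Finite := by
  induction t using NNReal.continuous_induction with
  | left t ih =>
    rcases eq_zero_or_pos t with rfl | ht
    · simp
    · have := NNReal.neBot_nhdsLT ht
      obtain ⟨r, hr, hrt⟩ := ((hn.eventually_left ht).and self_mem_nhdsWithin).exists
      refine ((ih r hrt).union (finite_singleton t)).subset fun s hs => ?_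
      rcases le_or_gt s r with h | h
      · exact Or.inl ⟨⟨hs.1.1, h⟩, hs.2⟩
      · rcases hs.1.2.lt_or_eq with h' | h'
        · exact absurd (hr s ⟨h, h'⟩) hs.2
        · exact Or.inr h'
  | right t ih =>
    filter_upwards [hn.eventually_right t] with u hu
    refine (ih t le_rfl).subset fun s hs => ?_
    rcases le_or_gt s t with h | h
    · exact ⟨⟨hs.1.1, h⟩, hs.2⟩
    · exact absurd (hu s ⟨h, hs.1.2⟩) hs.2

end IsCountingPath

/-! ### Compensated integrals -/

section CompensatedIntegral

variable {F : Type*} [NormedAddCommGroup F]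

/-- Integrability on all bounded intervals of the half line. -/
def LocIntegrable (G : ℝ → F) : Prop := ∀ t : ℝ≥0, IntervalIntegrable G volume 0 t

theorem LocIntegrable.intervalIntegrable {G : ℝ → F} (h : LocIntegrable G) (a b : ℝ≥0) :
    IntervalIntegrable G volume a b := (h a).symm.trans (h b)

theorem LocIntegrable.add {G K : ℝ → F} (h : LocIntegrable G) (k : LocIntegrable K) :
    LocIntegrable (fun s => G s + K s) := fun t => (h t).add (k t)

theorem LocIntegrable.sum {ι : Type*} [Fintype ι] {G : ι → ℝ → F}
    (h : ∀ α, LocIntegrable (G α)) : LocIntegrable (fun s => ∑ α, G α s) := fun t => by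
  have := IntervalIntegrable.sum (μ := volume) (a := 0) (b := (t : ℝ)) Finset.univ
    (f := G) fun α _ => h α t
  rwa [show (∑ α, G α) = fun s => ∑ α, G α s from funext fun s => Finset.sum_apply _ _ _] at this

theorem LocIntegrable.congr {G K : ℝ → F} (h : LocIntegrable G)
    (hk : ∀ᵐ s : ℝ ∂volume, 0 ≤ s → G s = K s) : LocIntegrable K := fun t => by
  refine (h t).congr_ae ?_
  rw [uIoc_of_le t.coe_nonneg]
  filter_upwards [ae_restrict_of_ae hk, ae_restrict_mem measurableSet_Ioc] with s hs hs'
  exact hs hs'.1.le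

theorem IsCountingPath.finite_support {n : ℝ≥0 → ℕ} {g : ℝ≥0 → F} (hn : IsCountingPath n)
    (t : ℝ≥0) : (Ioc 0 t ∩ Function.support fun s => jumpSize n s • g s).Finite := by
  refine (hn.finite_jumps t).subset fun s hs => ⟨hs.1, fun h => hs.2 ?_⟩
  simp [h]

variable [NormedSpace ℝ F]

theorem intervalIntegral_congr_nonneg {G K : ℝ → F}
    (hk : ∀ᵐ s : ℝ ∂volume, 0 ≤ s → G s = K s) (a b : ℝ≥0) :
    ∫ s in (a : ℝ)..b, G s = ∫ s in (a : ℝ)..b, K s := by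
  refine intervalIntegral.integral_congr_ae ?_
  filter_upwards [hk] with s hs hs'
  exact hs ((le_min a.2 b.2).trans hs'.1.le)

theorem LocIntegrable.continuous_primitive {G : ℝ → F} (h : LocIntegrable G) :
    Continuous fun t : ℝ≥0 => ∫ s in (0 : ℝ)..t, G s := by
  rw [continuous_iff_continuousAt]
  intro t
  have h1 : ContinuousOn (fun x : ℝ => ∫ s in (0 : ℝ)..x, G s) (uIcc 0 ((t + 1 : ℝ≥0) : ℝ)) :=
    intervalIntegral.continuousOn_primitive_interval' (h (t + 1)) left_mem_uIcc
  rw [uIcc_of_le (t + 1).coe_nonneg] at h1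
  have h2 : ContinuousOn (fun t : ℝ≥0 => ∫ s in (0 : ℝ)..t, G s) (Iic (t + 1)) :=
    h1.comp NNReal.continuous_coe.continuousOn fun x hx => ⟨x.2, NNReal.coe_le_coe.2 hx⟩
  exact h2.continuousAt (Iic_mem_nhds (by simp))

variable {n : ℝ≥0 → ℕ} {g : ℝ≥0 → F}

theorem compensatedIntegral_zero : compensatedIntegral n g 0 = 0 := by
  simp [compensatedIntegral]

theorem compensatedIntegral_eventually_right (hn : IsCountingPath n)
    (hg : LocIntegrable fun s => g s.toNNReal) (t : ℝ≥0) :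
    ∀ᶠ u in 𝓝[>] t, compensatedIntegral n g u
      = compensatedIntegral n g t - ∫ s in (t : ℝ)..u, g s.toNNReal := by
  filter_upwards [hn.eventually_right t, self_mem_nhdsWithin] with u hu htu
  rw [mem_Ioi] at htu
  have h1 : ∑ᶠ (s : ℝ≥0) (_ : s ∈ Ioc 0 u), jumpSize n s • g s
      = ∑ᶠ (s : ℝ≥0) (_ : s ∈ Ioc 0 t), jumpSize n s • g s := by
    refine finsum_mem_inter_support_eq' _ _ _ fun s hs => ?_
    refine ⟨fun h => ⟨h.1, ?_⟩, fun h => ⟨h.1, h.2.trans htu.le⟩⟩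
    by_contra! h'
    exact hs (by simp [hu s ⟨h', h.2⟩])
  rw [compensatedIntegral, compensatedIntegral, h1,
    ← intervalIntegral.integral_add_adjacent_intervals (hg t) (hg.intervalIntegrable t u)]
  abel

theorem compensatedIntegral_tendsto_left (hn : IsCountingPath n)
    (hg : LocIntegrable fun s => g s.toNNReal) {t : ℝ≥0} (ht : 0 < t) :
    Tendsto (compensatedIntegral n g) (𝓝[<] t)
      (𝓝 (compensatedIntegral n g t - jumpSize n t • g t)) := by
  have h1 : ∀ᶠ r in 𝓝[<] t, ∑ᶠ (s : ℝ≥0) (_ : s ∈ Ioc 0 r), jumpSize n s • g s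
      = (∑ᶠ (s : ℝ≥0) (_ : s ∈ Ioc 0 t), jumpSize n s • g s) - jumpSize n t • g t := by
    filter_upwards [hn.eventually_left ht, self_mem_nhdsWithin] with r hr hrt
    rw [mem_Iio] at hrt
    have h2 : ∑ᶠ (s : ℝ≥0) (_ : s ∈ Ioc 0 t), jumpSize n s • g s
        = ∑ᶠ (s : ℝ≥0) (_ : s ∈ insert t (Ioc 0 r)), jumpSize n s • g s := by
      refine finsum_mem_inter_support_eq' _ _ _ fun s hs => ?_
      refine ⟨fun h => ?_, fun h => ?_⟩
      · by_contra! h'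
        rw [mem_insert_iff, not_or] at h'
        have h3 : r < s := by
          by_contra! h3
          exact h'.2 ⟨h.1, h3⟩
        exact hs (by simp [hr s ⟨h3, lt_of_le_of_ne h.2 h'.1⟩])
      · rcases h with rfl | h
        · exact ⟨ht, le_rfl⟩
        · exact ⟨h.1, h.2.trans hrt.le⟩
    rw [h2, finsum_mem_insert' _ (fun h => absurd h.2 (not_le.2 hrt)) (hn.finite_support r)]
    abel
  have h2 : Tendsto (fun r : ℝ≥0 => ∫ s in (0 : ℝ)..r, g s.toNNReal) (𝓝[<] t)
      (𝓝 (∫ s in (0 : ℝ)..t, g s.toNNReal)) :=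
    (hg.continuous_primitive.tendsto t).mono_left nhdsWithin_le_nhds
  have h3 := (tendsto_const_nhds (f := 𝓝[<] t)
    (x := (∑ᶠ (s : ℝ≥0) (_ : s ∈ Ioc 0 t), jumpSize n s • g s) - jumpSize n t • g t)).sub h2
  have h4 : compensatedIntegral n g t - jumpSize n t • g t
      = (∑ᶠ (s : ℝ≥0) (_ : s ∈ Ioc 0 t), jumpSize n s • g s) - jumpSize n t • g t
        - ∫ s in (0 : ℝ)..t, g s.toNNReal := by
    rw [compensatedIntegral]; abel
  rw [h4]
  refine h3.congr' ?_
  filter_upwards [h1] with r hr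
  rw [compensatedIntegral, hr]

/-- The local form of the integral equation
`y_t = y_0 + ∑_α ∫_0^t g_α dñ_α - ∫_0^t h_s ds`. -/
structure EvolvesBy {ι : Type*} [Fintype ι] (n : ι → ℝ≥0 → ℕ) (g : ι → ℝ≥0 → F) (h : ℝ → F)
    (y : ℝ≥0 → F) : Prop where
  jump : ∀ t, 0 < t → Tendsto y (𝓝[<] t) (𝓝 (y t - ∑ α, jumpSize (n α) t • g α t))
  flow : ∀ t, ∀ᶠ u in 𝓝[>] t, y u = y t - ∫ s in (t : ℝ)..u, (∑ α, g α s.toNNReal + h s)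

variable {ι : Type*} [Fintype ι] {n : ι → ℝ≥0 → ℕ} {g : ι → ℝ≥0 → F} {h : ℝ → F}
  {y z : ℝ≥0 → F}

theorem evolvesBy_of_equation {c : F} (hn : ∀ α, IsCountingPath (n α))
    (hg : ∀ α, LocIntegrable fun s => g α s.toNNReal) (hh : LocIntegrable h)
    (hy : ∀ t : ℝ≥0, y t
      = c + ∑ α, compensatedIntegral (n α) (g α) t - ∫ s in (0 : ℝ)..t, h s) :
    EvolvesBy n g h y := by
  obtain rfl : y = fun t : ℝ≥0 =>
      c + ∑ α, compensatedIntegral (n α) (g α) t - ∫ s in (0 : ℝ)..t, h s := funext hy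
  refine ⟨fun t ht => ?_, fun t => ?_⟩
  · have h1 := tendsto_finsetSum Finset.univ fun α (_ : α ∈ Finset.univ) =>
      compensatedIntegral_tendsto_left (hn α) (hg α) ht
    have h2 := (hh.continuous_primitive.tendsto t).mono_left (nhdsWithin_le_nhds (s := Iio t))
    convert (h1.const_add c).sub h2 using 2
    rw [Finset.sum_sub_distrib]
    abel
  · have h1 := (eventually_all (l := 𝓝[>] t)).2 fun α =>
      compensatedIntegral_eventually_right (hn α) (hg α) t
    filter_upwards [h1] with u hu
    have hgi : ∀ α ∈ Finset.univ,
        IntervalIntegrable (fun s : ℝ => g α s.toNNReal) volume t u :=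
      fun α _ => (hg α).intervalIntegrable t u
    rw [intervalIntegral.integral_add ((LocIntegrable.sum hg).intervalIntegrable t u)
      (hh.intervalIntegrable t u), intervalIntegral.integral_finsetSum hgi,
      Finset.sum_congr rfl fun α _ => hu α, Finset.sum_sub_distrib,
      ← intervalIntegral.integral_add_adjacent_intervals (hh t) (hh.intervalIntegrable t u)]
    abel

/-- With the integrands prescribed, the jump rule determines the value at `t` from earlier values
and the flow rule determines the right germ. -/
theorem EvolvesBy.unique (hy : EvolvesBy n g h y) (hz : EvolvesBy n g h z) (h0 : y 0 = z 0)
    (t : ℝ≥0) : y t = z t := by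
  induction t using NNReal.continuous_induction with
  | left t ih =>
    rcases eq_zero_or_pos t with rfl | ht
    · exact h0
    · have := NNReal.neBot_nhdsLT ht
      have h1 := (hy.jump t ht).congr' (f₂ := z)
        (by filter_upwards [self_mem_nhdsWithin] with s hs using ih s hs)
      exact sub_left_injective (tendsto_nhds_unique h1 (hz.jump t ht))
  | right t ih =>
    filter_upwards [hy.flow t, hz.flow t] with u h1 h2
    rw [h1, h2, ih t le_rfl]

/-- The right-hand side obeys the same local rules, so uniqueness recovers the integral equation
from them. -/
theorem EvolvesBy.equation (hn : ∀ α, IsCountingPath (n α))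
    (hg : ∀ α, LocIntegrable fun s => g α s.toNNReal) (hh : LocIntegrable h)
    (hy : EvolvesBy n g h y) (t : ℝ≥0) :
    y t = y 0 + ∑ α, compensatedIntegral (n α) (g α) t - ∫ s in (0 : ℝ)..t, h s :=
  hy.unique (evolvesBy_of_equation (c := y 0) hn hg hh fun _ => rfl)
    (by simp [compensatedIntegral_zero]) t

end CompensatedIntegral
/-! ### Jumps of Poisson processes -/

theorem poissonMeasure_one_le (r : ℝ≥0) : poissonMeasure r {k | 1 ≤ k} ≤ (r : ENNReal) := by
  have h1 : {k : ℕ | 1 ≤ k} = {0}ᶜ := by ext k; simp; omega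
  have h2 : (poissonMeasure r).real {k | 1 ≤ k} ≤ r := by
    rw [h1, probReal_compl_eq_one_sub (measurableSet_singleton 0), poissonMeasure_real_singleton]
    have := Real.add_one_le_exp (-(r : ℝ))
    simp
    linarith
  rw [← ENNReal.ofReal_coe_nnreal, ← ofReal_measureReal]
  exact ENNReal.ofReal_le_ofReal h2

/-- By `exp (-r) ≥ 1 - r`, the mass of `{0, 1}` is `(1 + r) exp (-r) ≥ 1 - r²`. -/
theorem poissonMeasure_two_le (r : ℝ≥0) :
    poissonMeasure r {k | 2 ≤ k} ≤ ((r ^ 2 : ℝ≥0) : ENNReal) := by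
  have h1 : {k : ℕ | 2 ≤ k} = ({0} ∪ {1})ᶜ := by ext k; simp; omega
  have h2 : (poissonMeasure r).real {k | 2 ≤ k} ≤ (r : ℝ) ^ 2 := by
    rw [h1, probReal_compl_eq_one_sub (by measurability),
      measureReal_union (by simp) (measurableSet_singleton 1), poissonMeasure_real_singleton,
      poissonMeasure_real_singleton]
    have := Real.add_one_le_exp (-(r : ℝ))
    have h0 : (0 : ℝ) ≤ r := r.2
    simp
    nlinarith
  rw [← ENNReal.ofReal_coe_nnreal, ← ofReal_measureReal]
  exact ENNReal.ofReal_le_ofReal (by simpa using h2)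

/-- A union bound: if an event is implied, for each cell of a partition of the time axis into small
intervals, with probability quadratic in the length of the cell, then it is null. -/
theorem ae_not_forall_cell {Ω : Type*} {mΩ : MeasurableSpace Ω} {P : Measure Ω}
    {D : ℝ≥0 → ℝ≥0 → Set Ω}
    (hD : ∀ a b, a ≤ b → P (D a b) ≤ (((b - a) ^ 2 : ℝ≥0) : ENNReal)) :
    ∀ᵐ ω ∂P, ∀ s : ℝ≥0, 0 < s → ∃ a b, a < s ∧ s ≤ b ∧ ω ∉ D a b := by
  have key : ∀ T : ℕ, ∀ᵐ ω ∂P, ∀ s : ℝ≥0, 0 < s → s ≤ T → ∃ a b, a < s ∧ s ≤ b ∧ ω ∉ D a b := by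
    intro T
    rw [ae_iff]
    have hn : ∀ n : ℕ, P {ω | ¬ ∀ s : ℝ≥0, 0 < s → s ≤ T → ∃ a b, a < s ∧ s ≤ b ∧ ω ∉ D a b}
        ≤ ((T / (n + 1) : ℝ≥0) : ENNReal) := by
      intro n
      have hpos : (0 : ℝ≥0) < n + 1 := by positivity
      have hsub : {ω | ¬ ∀ s : ℝ≥0, 0 < s → s ≤ T → ∃ a b, a < s ∧ s ≤ b ∧ ω ∉ D a b}
          ⊆ ⋃ k ∈ Finset.range (T * (n + 1)),
            D ((k : ℝ≥0) / (n + 1)) (((k : ℝ≥0) + 1) / (n + 1)) := by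
        intro ω hω
        simp only [mem_ofPred_eq] at hω
        push Not at hω
        obtain ⟨s, hs0, hsT, hs⟩ := hω
        -- The cell of `s` has index `⌈s (n + 1)⌉ - 1`, so that cells are open on the left and
        -- closed on the right. The `T (n + 1)` cells cost `1 / (n + 1)²` each.
        have hc : 0 < ⌈s * (n + 1)⌉₊ := Nat.ceil_pos.2 (by positivity)
        obtain ⟨k, hk⟩ := Nat.exists_eq_succ_of_ne_zero hc.ne'
        have h1 : (k : ℝ≥0) < s * (n + 1) := Nat.lt_ceil.1 (by omega)
        have h2 : s * (n + 1) ≤ (k : ℝ≥0) + 1 := by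
          have := Nat.le_ceil (s * (n + 1) : ℝ≥0)
          rw [hk] at this
          simpa using this
        refine mem_biUnion (x := k) ?_ (hs _ _ ((div_lt_iff₀ hpos).2 h1) ((le_div_iff₀ hpos).2 h2))
        have h3 : (k : ℝ≥0) < ((T * (n + 1) : ℕ) : ℝ≥0) := by
          push_cast
          exact h1.trans_le (by gcongr)
        exact Finset.mem_coe.2 (Finset.mem_range.2 (by exact_mod_cast h3))
      calc _ ≤ _ := measure_mono hsub
        _ ≤ ∑ k ∈ Finset.range (T * (n + 1)),
            P (D ((k : ℝ≥0) / (n + 1)) (((k : ℝ≥0) + 1) / (n + 1))) :=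
          measure_biUnion_finset_le _ _
        _ ≤ ∑ k ∈ Finset.range (T * (n + 1)), (((1 / (n + 1)) ^ 2 : ℝ≥0) : ENNReal) := by
          refine Finset.sum_le_sum fun k _ => (hD _ _ (by gcongr; simp)).trans_eq ?_
          rw [add_div, add_tsub_cancel_left]
        _ = ((T / (n + 1) : ℝ≥0) : ENNReal) := by
          rw [Finset.sum_const, Finset.card_range, nsmul_eq_mul, ← ENNReal.coe_natCast,
            ← ENNReal.coe_mul]
          congr 1
          push_cast
          field_simp
    have hlim : Tendsto (fun n : ℕ => ((T / (n + 1) : ℝ≥0) : ENNReal)) atTop (𝓝 0) := by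
      rw [← ENNReal.coe_zero, ENNReal.tendsto_coe]
      have := (tendsto_one_div_add_atTop_nhds_zero_nat (𝕜 := ℝ≥0)).const_mul (T : ℝ≥0)
      simpa [div_eq_mul_inv] using this
    exact le_antisymm (ge_of_tendsto' hlim hn) zero_le
  filter_upwards [ae_all_iff.2 key] with ω hω s hs
  obtain ⟨T, hT⟩ := exists_nat_ge s
  exact hω T s hs hT

theorem jumpSize_le_sub {n : ℝ≥0 → ℕ} (hn : Monotone n) {a s b : ℝ≥0} (h : a < s) (h' : s ≤ b) :
    jumpSize n s ≤ n b - n a := by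
  have h1 := hn h'
  have h2 := hn.le_leftLim h
  rw [jumpSize]
  omega

namespace IsPoissonFamily

variable {Ω ι : Type*} {mΩ : MeasurableSpace Ω} {𝓕 : Filtration ℝ≥0 mΩ}
    {P : Measure Ω} {N : ι → ℝ≥0 → Ω → ℕ}

theorem isCountingPath (hN : IsPoissonFamily 𝓕 P N) (α : ι) (ω : Ω) :
    IsCountingPath fun t => N α t ω :=
  ⟨hN.mono α ω, hN.right_continuous α ω⟩

theorem ae_jumpSize_le_one (hN : IsPoissonFamily 𝓕 P N) (α : ι) :
    ∀ᵐ ω ∂P, ∀ s, 0 < s → jumpSize (fun t => N α t ω) s ≤ 1 := by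
  have h := ae_not_forall_cell (P := P) (D := fun a b => {ω | 2 ≤ N α b ω - N α a ω})
    fun a b hab => by
      rw [(hN.increment_law α a b hab).measure_eq (p := fun k => 2 ≤ k) (MeasurableSet.of_discrete)]
      exact poissonMeasure_two_le _
  filter_upwards [h] with ω hω s hs
  obtain ⟨a, b, ha, hb, hab⟩ := hω s hs
  have h1 := jumpSize_le_sub (hN.mono α ω) ha hb
  simp only [not_le] at hab
  omega

/-- A common jump puts a jump of both processes in one cell; by independence this has probability at
most the squared length of the cell. -/
theorem ae_jumpSize_eq_zero_or (hN : IsPoissonFamily 𝓕 P N) {α β : ι} (hαβ : α ≠ β) :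
    ∀ᵐ ω ∂P, ∀ s, 0 < s →
      jumpSize (fun t => N α t ω) s = 0 ∨ jumpSize (fun t => N β t ω) s = 0 := by
  have h := ae_not_forall_cell (P := P)
    (D := fun a b => {ω | 1 ≤ N α b ω - N α a ω} ∩ {ω | 1 ≤ N β b ω - N β a ω})
    fun a b hab => by
      have hm : Measurable fun f : ℝ≥0 → ℕ => f b - f a :=
        (measurable_pi_apply b).sub (measurable_pi_apply a)
      have hi : IndepFun (fun ω => N α b ω - N α a ω) (fun ω => N β b ω - N β a ω) P :=
        (hN.indep.indepFun hαβ).comp hm hm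
      have hi' := hi.measure_inter_preimage_eq_mul {k | 1 ≤ k} {k | 1 ≤ k}
        MeasurableSet.of_discrete MeasurableSet.of_discrete
      have h1 : ∀ γ, P {ω | 1 ≤ N γ b ω - N γ a ω} ≤ ((b - a : ℝ≥0) : ENNReal) := fun γ => by
        rw [(hN.increment_law γ a b hab).measure_eq (p := fun k => 1 ≤ k)
          (MeasurableSet.of_discrete)]
        exact poissonMeasure_one_le _
      calc _ = _ := hi'
        _ ≤ ((b - a : ℝ≥0) : ENNReal) * ((b - a : ℝ≥0) : ENNReal) := mul_le_mul' (h1 α) (h1 β)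
        _ = _ := by rw [← ENNReal.coe_mul, sq]
  filter_upwards [h] with ω hω s hs
  obtain ⟨a, b, ha, hb, hab⟩ := hω s hs
  have h1 := jumpSize_le_sub (hN.mono α ω) ha hb
  have h2 := jumpSize_le_sub (hN.mono β ω) ha hb
  simp only [mem_inter_iff, mem_ofPred_eq, not_and_or] at hab
  omega

/-- Almost surely, at each time at most one of the processes jumps, and by one. -/
theorem ae_jumpSize_cases [Finite ι] (hN : IsPoissonFamily 𝓕 P N) :
    ∀ᵐ ω ∂P, ∀ s, 0 < s → (∀ α, jumpSize (fun t => N α t ω) s = 0) ∨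
      ∃ α, jumpSize (fun t => N α t ω) s = 1 ∧
        ∀ β, β ≠ α → jumpSize (fun t => N β t ω) s = 0 := by
  have h1 := ae_all_iff.2 hN.ae_jumpSize_le_one
  have h2 : ∀ᵐ ω ∂P, ∀ α β : ι, α ≠ β → ∀ s, 0 < s →
      jumpSize (fun t => N α t ω) s = 0 ∨ jumpSize (fun t => N β t ω) s = 0 :=
    ae_all_iff.2 fun α => ae_all_iff.2 fun β => by
      by_cases h : α = β
      · simp [h]
      · simpa [h] using hN.ae_jumpSize_eq_zero_or h
  filter_upwards [h1, h2] with ω h1 h2 s hs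
  by_cases h : ∀ α, jumpSize (fun t => N α t ω) s = 0
  · exact Or.inl h
  · push Not at h
    obtain ⟨α, hα⟩ := h
    refine Or.inr ⟨α, ?_, fun β hβ => (h2 β α hβ s hs).resolve_right hα⟩
    have := h1 α s hs
    omega

end IsPoissonFamily
/-! ### Càdlàg paths -/

section Cadlag

variable {F : Type*} [NormedAddCommGroup F]

theorem leftLim_zero_eq {F : Type*} [TopologicalSpace F] (x : ℝ≥0 → F) :
    Function.leftLim x 0 = x 0 :=
  leftLim_eq_of_eq_bot x (by simp)

/-- No left limit need exist, since `leftLim` then falls back to the value. This matters for the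
norm ratio of a path tending to zero. -/
theorem leftLim_mem_of_isClosed {F : Type*} [TopologicalSpace F] [T2Space F] {x : ℝ≥0 → F}
    {s : Set F} (hs : IsClosed s) (hx : ∀ t, x t ∈ s) (t : ℝ≥0) : Function.leftLim x t ∈ s := by
  rcases eq_zero_or_pos t with rfl | ht
  · rw [leftLim_zero_eq]
    exact hx 0
  · have := NNReal.neBot_nhdsLT ht
    by_cases h : ∃ y, Tendsto x (𝓝[<] t) (𝓝 y)
    · exact hs.mem_of_tendsto (tendsto_leftLim_of_tendsto h) (Eventually.of_forall hx)
    · rw [leftLim_eq_of_not_tendsto _ h]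
      exact hx t

theorem ContinuousAt.leftLim_eq {F : Type*} [TopologicalSpace F] [T2Space F] {x : ℝ≥0 → F}
    {t : ℝ≥0} (h : ContinuousAt x t) : Function.leftLim x t = x t := by
  rcases eq_zero_or_pos t with rfl | ht
  · exact leftLim_zero_eq x
  · have := NNReal.neBot_nhdsLT ht
    exact leftLim_eq_of_tendsto (h.tendsto.mono_left nhdsWithin_le_nhds)

theorem IsCadlag.tendsto_leftLim {F : Type*} [TopologicalSpace F] [T2Space F] {x : ℝ≥0 → F}
    (hx : IsCadlag x) (t : ℝ≥0) :
    Tendsto x (𝓝[<] t) (𝓝 (Function.leftLim x t)) :=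
  tendsto_leftLim_of_tendsto (hx t).2

theorem IsCadlag.exists_bound {x : ℝ≥0 → F} (hx : IsCadlag x) (t : ℝ≥0) :
    ∃ B, ∀ s ≤ t, ‖x s‖ ≤ B := by
  induction t using NNReal.continuous_induction with
  | left t ih =>
    rcases eq_zero_or_pos t with rfl | ht
    · exact ⟨‖x 0‖, fun s hs => by rw [nonpos_iff_eq_zero.1 hs]⟩
    · have := NNReal.neBot_nhdsLT ht
      obtain ⟨l, hl⟩ := (hx t).2
      have h1 : ∀ᶠ r in 𝓝[<] t, ‖x r‖ < ‖l‖ + 1 := hl.norm.eventually_lt_const (by simp)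
      obtain ⟨r, hr, hr'⟩ := (mem_nhdsLT_iff_exists_Ioo_subset' ht).1 h1
      obtain ⟨B, hB⟩ := ih r hr
      refine ⟨max B (max (‖l‖ + 1) ‖x t‖), fun s hs => ?_⟩
      rcases le_or_gt s r with h | h
      · exact (hB s h).trans (le_max_left _ _)
      · rcases hs.lt_or_eq with h' | rfl
        · exact (hr' ⟨h, h'⟩).le.trans ((le_max_left _ _).trans (le_max_right _ _))
        · exact (le_max_right _ _).trans (le_max_right _ _)
  | right t ih =>
    have h1 : ∀ᶠ r in 𝓝[≥] t, ‖x r‖ < ‖x t‖ + 1 :=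
      (hx t).1.tendsto.norm.eventually_lt_const (by simp)
    obtain ⟨b, hb, hb'⟩ := (mem_nhdsGE_iff_exists_Ico_subset).1 h1
    obtain ⟨B, hB⟩ := ih t le_rfl
    filter_upwards [Ioo_mem_nhdsGT hb] with u hu
    refine ⟨max B (‖x t‖ + 1), fun s hs => ?_⟩
    rcases le_or_gt s t with h | h
    · exact (hB s h).trans (le_max_left _ _)
    · exact (hb' ⟨h.le, hs.trans_lt hu.2⟩).le.trans (le_max_right _ _)

theorem tendsto_ceil_div (s : ℝ≥0) :
    Tendsto (fun k : ℕ => ((⌈s * (k + 1)⌉₊ : ℕ) : ℝ≥0) / (k + 1)) atTop (𝓝[≥] s) := by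
  have h1 : ∀ k : ℕ, s ≤ ((⌈s * (k + 1)⌉₊ : ℕ) : ℝ≥0) / (k + 1) := fun k => by
    rw [le_div_iff₀ (by positivity)]
    exact Nat.le_ceil _
  have h2 : ∀ k : ℕ, ((⌈s * (k + 1)⌉₊ : ℕ) : ℝ≥0) / (k + 1) ≤ s + 1 / (k + 1) := fun k => by
    rw [div_le_iff₀ (by positivity), add_mul, one_div_mul_cancel (by positivity)]
    exact (Nat.ceil_lt_add_one zero_le).le
  refine tendsto_nhdsWithin_iff.2 ⟨?_, Eventually.of_forall h1⟩
  refine tendsto_of_tendsto_of_tendsto_of_le_of_le tendsto_const_nhds ?_ h1 h2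
  simpa using (tendsto_one_div_add_atTop_nhds_zero_nat (𝕜 := ℝ≥0)).const_add s

/-- Ceiling minus one, unlike the floor, stays strictly below `s` even at grid points. -/
theorem tendsto_ceil_sub_one_div {s : ℝ≥0} (hs : 0 < s) :
    Tendsto (fun k : ℕ => ((⌈s * (k + 1)⌉₊ - 1 : ℕ) : ℝ≥0) / (k + 1)) atTop (𝓝[<] s) := by
  have h0 : ∀ k : ℕ, ((⌈s * (k + 1)⌉₊ - 1 : ℕ) : ℝ≥0) + 1 = (⌈s * (k + 1)⌉₊ : ℕ) := fun k => by
    have : 0 < ⌈s * (k + 1)⌉₊ := Nat.ceil_pos.2 (by positivity)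
    exact_mod_cast Nat.sub_add_cancel this
  have h1 : ∀ k : ℕ, ((⌈s * (k + 1)⌉₊ - 1 : ℕ) : ℝ≥0) / (k + 1) < s := fun k => by
    rw [div_lt_iff₀ (by positivity)]
    have := Nat.ceil_lt_add_one (a := s * (k + 1)) zero_le
    rw [← h0] at this
    exact lt_of_add_lt_add_right this
  have h2 : ∀ k : ℕ, s - 1 / (k + 1) ≤ ((⌈s * (k + 1)⌉₊ - 1 : ℕ) : ℝ≥0) / (k + 1) := fun k => by
    rw [tsub_le_iff_right, ← add_div, h0, le_div_iff₀ (by positivity)]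
    exact Nat.le_ceil _
  refine tendsto_nhdsWithin_iff.2 ⟨?_, Eventually.of_forall h1⟩
  refine tendsto_of_tendsto_of_tendsto_of_le_of_le ?_ tendsto_const_nhds h2 fun k => (h1 k).le
  simpa using (tendsto_const_nhds (x := s)).sub
    (tendsto_one_div_add_atTop_nhds_zero_nat (𝕜 := ℝ≥0))

/-- Sampling at the next grid point factors through a countable index, hence is jointly measurable,
and converges by right continuity. -/
theorem stronglyMeasurable_uncurry_of_right_continuous {Ω : Type*} [MeasurableSpace Ω]
    {y : ℝ≥0 → Ω → F} (hy : ∀ t, StronglyMeasurable (y t))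
    (hr : ∀ ω t, ContinuousWithinAt (fun s => y s ω) (Ici t) t) :
    StronglyMeasurable (Function.uncurry y) := by
  refine stronglyMeasurable_of_tendsto (u := atTop)
    (f := fun (k : ℕ) (p : ℝ≥0 × Ω) => y (((⌈p.1 * (k + 1)⌉₊ : ℕ) : ℝ≥0) / (k + 1)) p.2)
    (fun k => ?_) (tendsto_pi_nhds.2 fun p => (hr p.2 p.1).tendsto.comp (tendsto_ceil_div p.1))
  have h1 : StronglyMeasurable
      (Function.uncurry fun (j : ℕ) (ω : Ω) => y ((j : ℝ≥0) / (k + 1)) ω) :=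
    stronglyMeasurable_uncurry_of_continuous_of_stronglyMeasurable
      (fun ω => continuous_of_discreteTopology) fun j => hy _
  have h2 : Measurable fun p : ℝ≥0 × Ω => (⌈p.1 * (k + 1)⌉₊, p.2) :=
    (Nat.measurable_ceil.comp (measurable_fst.mul_const _)).prodMk measurable_snd
  exact h1.comp_measurable h2

theorem stronglyMeasurable_of_right_continuous {x : ℝ≥0 → F}
    (hx : ∀ t, ContinuousWithinAt x (Ici t) t) : StronglyMeasurable x :=
  (stronglyMeasurable_uncurry_of_right_continuous (Ω := Unit) (y := fun t _ => x t)
    (fun _ => stronglyMeasurable_const) fun _ => hx).comp_measurable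
    (measurable_id.prodMk (measurable_const (a := ())))

theorem IsCadlag.stronglyMeasurable {x : ℝ≥0 → F} (hx : IsCadlag x) : StronglyMeasurable x :=
  stronglyMeasurable_of_right_continuous fun t => (hx t).1

theorem IsCadlag.stronglyMeasurable_leftLim {x : ℝ≥0 → F} (hx : IsCadlag x) :
    StronglyMeasurable (Function.leftLim x) := by
  refine stronglyMeasurable_of_tendsto (u := atTop)
    (f := fun (k : ℕ) (s : ℝ≥0) => x (((⌈s * (k + 1)⌉₊ - 1 : ℕ) : ℝ≥0) / (k + 1)))
    (fun k => ?_) (tendsto_pi_nhds.2 fun s => ?_)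
  · have h1 : StronglyMeasurable fun j : ℕ => x (((j - 1 : ℕ) : ℝ≥0) / (k + 1)) :=
      continuous_of_discreteTopology.stronglyMeasurable
    exact h1.comp_measurable (Nat.measurable_ceil.comp (measurable_id.mul_const _))
  · rcases eq_zero_or_pos s with rfl | hs
    · simp [leftLim_zero_eq]
    · exact (hx.tendsto_leftLim s).comp (tendsto_ceil_sub_one_div hs)

theorem LocIntegrable.of_bound {G : ℝ → F} (hG : AEStronglyMeasurable G volume)
    (hb : ∀ t : ℝ≥0, ∃ B, ∀ s : ℝ, 0 ≤ s → s ≤ t → ‖G s‖ ≤ B) : LocIntegrable G := fun t => by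
  obtain ⟨B, hB⟩ := hb t
  rw [intervalIntegrable_iff, uIoc_of_le t.coe_nonneg]
  refine Measure.integrableOn_of_bounded (M := B) measure_Ioc_lt_top.ne hG ?_
  filter_upwards [ae_restrict_mem measurableSet_Ioc] with s hs
  exact hB s hs.1.le hs.2

theorem IsCadlag.exists_bound_leftLim {x : ℝ≥0 → F} (hx : IsCadlag x) (t : ℝ≥0) :
    ∃ B, ∀ s ≤ t, ‖Function.leftLim x s‖ ≤ B := by
  obtain ⟨B, hB⟩ := hx.exists_bound t
  refine ⟨B, fun s hs => ?_⟩
  rcases eq_zero_or_pos s with rfl | hs0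
  · rw [leftLim_zero_eq]
    exact hB 0 hs
  · have := NNReal.neBot_nhdsLT hs0
    refine le_of_tendsto (hx.tendsto_leftLim s).norm ?_
    filter_upwards [self_mem_nhdsWithin] with r hr
    exact hB r ((le_of_lt hr).trans hs)

theorem IsCadlag.locIntegrable {x : ℝ≥0 → F} (hx : IsCadlag x) :
    LocIntegrable fun s => x s.toNNReal :=
  .of_bound (hx.stronglyMeasurable.comp_measurable measurable_real_toNNReal).aestronglyMeasurable
    fun t => let ⟨B, hB⟩ := hx.exists_bound t
      ⟨B, fun _ _ hs => hB _ (Real.toNNReal_le_iff_le_coe.2 hs)⟩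

theorem IsCadlag.locIntegrable_leftLim {x : ℝ≥0 → F} (hx : IsCadlag x) :
    LocIntegrable fun s => Function.leftLim x s.toNNReal :=
  .of_bound
    (hx.stronglyMeasurable_leftLim.comp_measurable measurable_real_toNNReal).aestronglyMeasurable
    fun t => let ⟨B, hB⟩ := hx.exists_bound_leftLim t
      ⟨B, fun _ _ hs => hB _ (Real.toNNReal_le_iff_le_coe.2 hs)⟩

variable [NormedSpace ℝ F]

theorem EvolvesBy.eventually_continuousAt {ι : Type*} [Fintype ι] {n : ι → ℝ≥0 → ℕ}
    {g : ι → ℝ≥0 → F} {h : ℝ → F} {y : ℝ≥0 → F} (hy : EvolvesBy n g h y)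
    (hg : ∀ α, LocIntegrable fun s => g α s.toNNReal) (hh : LocIntegrable h) (t : ℝ≥0) :
    ∀ᶠ u in 𝓝[>] t, ContinuousAt y u := by
  obtain ⟨b, hb, hb'⟩ := (mem_nhdsGT_iff_exists_Ioo_subset).1 (hy.flow t)
  have hG := (LocIntegrable.sum hg).add hh
  filter_upwards [Ioo_mem_nhdsGT hb] with u hu
  have h1 : y =ᶠ[𝓝 u] fun r => y t - ((∫ s in (0 : ℝ)..r, (∑ α, g α s.toNNReal + h s))
      - ∫ s in (0 : ℝ)..t, (∑ α, g α s.toNNReal + h s)) := by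
    filter_upwards [Ioo_mem_nhds hu.1 hu.2] with r hr
    rw [hb' hr, intervalIntegral.integral_interval_sub_left (hG r) (hG t)]
  exact (continuousAt_congr h1).2
    (continuousAt_const.sub (hG.continuous_primitive.continuousAt.sub continuousAt_const))

end Cadlag
/-! ### The squared norm along an absolutely continuous path -/

/-- `φ` has zero derivative with respect to `A`: for each `ε`, a short step changes `φ` by at most
`ε` times the increment of `A`, and such steps are chained by continuous induction. -/
theorem eq_of_abs_sub_le_sq {φ A : ℝ≥0 → ℝ} {C : ℝ} (hA : Continuous A)
    (hmono : Monotone A) {t u : ℝ≥0} (htu : t ≤ u)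
    (h : ∀ r s, t ≤ r → r ≤ s → s ≤ u → |φ s - φ r| ≤ C * (A s - A r) ^ 2) : φ u = φ t := by
  have key : ∀ ε > 0, ∀ r, t ≤ r → r ≤ u → |φ r - φ t| ≤ ε * (A r - A t) := by
    intro ε hε r
    have step : ∀ r s, t ≤ r → r ≤ s → s ≤ u → C * (A s - A r) ≤ ε →
        |φ r - φ t| ≤ ε * (A r - A t) → |φ s - φ t| ≤ ε * (A s - A t) := by
      intro r s htr hrs hsu h1 h2
      have h3 := h r s htr hrs hsu
      have h4 := sub_nonneg.2 (hmono hrs)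
      have h5 : C * (A s - A r) ^ 2 ≤ ε * (A s - A r) := by
        rw [sq, ← mul_assoc]
        exact mul_le_mul_of_nonneg_right h1 h4
      have h6 := abs_sub_le (φ s) (φ r) (φ t)
      linarith
    induction r using NNReal.continuous_induction with
    | left r ih =>
      intro htr hru
      rcases htr.eq_or_lt with rfl | htr'
      · simp
      · have := NNReal.neBot_nhdsLT (zero_le.trans_lt htr')
        have h1 : Tendsto (fun s => C * (A r - A s)) (𝓝[<] r) (𝓝 (C * (A r - A r))) :=
          ((tendsto_const_nhds.sub (hA.tendsto r)).const_mul C).mono_left nhdsWithin_le_nhds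
        have h2 : ∀ᶠ s in 𝓝[<] r, C * (A r - A s) < ε :=
          h1.eventually_lt_const (by simpa using hε)
        obtain ⟨s, hs, hs1⟩ := (h2.and (Ioo_mem_nhdsLT htr')).exists
        exact step s r hs1.1.le hs1.2.le hru hs.le (ih s hs1.2 hs1.1.le (hs1.2.le.trans hru))
    | right r ih =>
      rcases lt_or_ge r t with hrt | htr
      · filter_upwards [Ioo_mem_nhdsGT hrt] with s hs hts
        exact absurd hs.2 (not_lt.2 hts)
      · have h1 : Tendsto (fun s => C * (A s - A r)) (𝓝[>] r) (𝓝 (C * (A r - A r))) :=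
          (((hA.tendsto r).sub tendsto_const_nhds).const_mul C).mono_left nhdsWithin_le_nhds
        have h2 : ∀ᶠ s in 𝓝[>] r, C * (A s - A r) < ε :=
          h1.eventually_lt_const (by simpa using hε)
        filter_upwards [h2, self_mem_nhdsWithin] with s hs hrs _ hsu
        have hrs' : r ≤ s := le_of_lt hrs
        exact step r s htr hrs' hsu hs.le (ih r le_rfl htr (hrs'.trans hsu))
  have h1 : |φ u - φ t| ≤ 0 := by
    have h2 : Tendsto (fun ε : ℝ => ε * (A u - A t)) (𝓝[>] 0) (𝓝 (0 * (A u - A t))) :=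
      (tendsto_id.mul_const _).mono_left nhdsWithin_le_nhds
    rw [zero_mul] at h2
    exact ge_of_tendsto h2 (by
      filter_upwards [self_mem_nhdsWithin] with ε hε using key ε hε u htu le_rfl)
  exact sub_eq_zero.1 (abs_nonpos_iff.1 h1)

section InnerProduct

variable {E : Type*} [NormedAddCommGroup E] [InnerProductSpace ℂ E] [CompleteSpace E]

theorem re_inner_intervalIntegral {k : ℝ → E} {a b : ℝ} (hk : IntervalIntegrable k volume a b)
    (w : E) : (inner ℂ (∫ s in a..b, k s) w).re = ∫ s in a..b, (inner ℂ (k s) w).re := by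
  have h := (Complex.reCLM.comp ((innerSL ℂ w).restrictScalars ℝ)).intervalIntegral_comp_comm hk
  have h1 : ∀ v : E, (inner ℂ v w).re = (inner ℂ w v).re := fun v => inner_re_symm (𝕜 := ℂ) v w
  simp only [h1]
  exact h.symm

/-- With `A = ∫ ‖k‖`, the increments of the two sides differ by a quantity quadratic in the
increment of `A`, so `eq_of_abs_sub_le_sq` applies. Only integrability of `k` is needed. -/
theorem norm_sq_eq_sub_integral {x : ℝ≥0 → E} {k : ℝ → E} (hx : IsCadlag x)
    (hk : LocIntegrable k) {t b : ℝ≥0}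
    (h : ∀ u, t ≤ u → u < b → x u = x t - ∫ s in (t : ℝ)..u, k s) {u : ℝ≥0} (htu : t ≤ u)
    (hub : u < b) :
    ‖x u‖ ^ 2 = ‖x t‖ ^ 2 - ∫ s in (t : ℝ)..u, 2 * (inner ℂ (k s) (x s.toNNReal)).re := by
  have hki : LocIntegrable fun s => ‖k s‖ := fun t => (hk t).norm
  have hinner : LocIntegrable fun s => 2 * (inner ℂ (k s) (x s.toNNReal)).re := fun t => by
    obtain ⟨B, hB⟩ := hx.exists_bound t
    refine IntervalIntegrable.const_mul ?_ 2
    have h1 := (hk t)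
    rw [intervalIntegrable_iff, uIoc_of_le t.coe_nonneg] at h1 ⊢
    refine Integrable.mono' (h1.norm.mul_const B) ?_ ?_
    · have hxm := (hx.stronglyMeasurable.comp_measurable
        measurable_real_toNNReal).aestronglyMeasurable (μ := volume.restrict (Ioc (0 : ℝ) t))
      exact Complex.continuous_re.comp_aestronglyMeasurable (h1.aestronglyMeasurable.inner hxm)
    · filter_upwards [ae_restrict_mem measurableSet_Ioc] with s hs
      calc ‖(inner ℂ (k s) (x s.toNNReal)).re‖ ≤ ‖inner ℂ (k s) (x s.toNNReal)‖ :=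
            Complex.abs_re_le_norm _
        _ ≤ ‖k s‖ * ‖x s.toNNReal‖ := norm_inner_le_norm _ _
        _ ≤ ‖k s‖ * B := by
          gcongr
          exact hB _ (Real.toNNReal_le_iff_le_coe.2 hs.2)
  set A : ℝ≥0 → ℝ := fun r => ∫ s in (0 : ℝ)..r, ‖k s‖ with hAdef
  have hAsub : ∀ r s : ℝ≥0, A s - A r = ∫ v in (r : ℝ)..s, ‖k v‖ := fun r s =>
    intervalIntegral.integral_interval_sub_left (hki s) (hki r)
  have hmono : Monotone A := fun r s hrs => by
    rw [← sub_nonneg, hAsub]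
    exact intervalIntegral.integral_nonneg hrs fun v _ => norm_nonneg _
  have hsub : ∀ r s, t ≤ r → r ≤ s → s < b → x s - x r = - ∫ v in (r : ℝ)..s, k v := by
    intro r s htr hrs hs
    rw [h s (htr.trans hrs) hs, h r htr (hrs.trans_lt hs),
      ← intervalIntegral.integral_interval_sub_left (hk.intervalIntegrable t s)
        (hk.intervalIntegrable t r)]
    abel
  have hsubA : ∀ r s, t ≤ r → r ≤ s → s < b → ‖x s - x r‖ ≤ A s - A r := by
    intro r s htr hrs hs
    rw [hsub r s htr hrs hs, norm_neg, hAsub]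
    exact intervalIntegral.norm_integral_le_integral_norm hrs
  set φ : ℝ≥0 → ℝ := fun r =>
    ‖x r‖ ^ 2 + ∫ s in (0 : ℝ)..r, 2 * (inner ℂ (k s) (x s.toNNReal)).re with hφ
  have hφeq : φ u = φ t := by
    refine eq_of_abs_sub_le_sq (C := 2) hki.continuous_primitive hmono htu ?_
    intro r s htr hrs hsu
    have hsb := hsu.trans_lt hub
    have h1 : ‖x s‖ ^ 2 - ‖x r‖ ^ 2 = (inner ℂ (x s - x r) (x s + x r)).re := by
      rw [inner_sub_left, inner_add_right, inner_add_right, ← inner_self_eq_norm_sq (𝕜 := ℂ),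
        ← inner_self_eq_norm_sq (𝕜 := ℂ)]
      have := inner_re_symm (𝕜 := ℂ) (x s) (x r)
      simp only [RCLike.re_to_complex] at this ⊢
      simp only [Complex.sub_re, Complex.add_re, this]
      ring
    have hkrs := hk.intervalIntegrable r s
    have hint : IntervalIntegrable (fun v => (inner ℂ (k v) (x s + x r)).re) volume r s := by
      have := (Complex.reCLM.comp
        ((innerSL ℂ (x s + x r)).restrictScalars ℝ)).integrable_comp hkrs.1
      rw [intervalIntegrable_iff, uIoc_of_le (NNReal.coe_le_coe.2 hrs)]
      refine this.congr (Eventually.of_forall fun v => ?_)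
      exact inner_re_symm (𝕜 := ℂ) (x s + x r) (k v)
    have h2 : φ s - φ r = ∫ v in (r : ℝ)..s, (2 * (inner ℂ (k v) (x v.toNNReal)).re
        - (inner ℂ (k v) (x s + x r)).re) := by
      rw [intervalIntegral.integral_sub (hinner.intervalIntegrable r s) hint,
        ← re_inner_intervalIntegral hkrs,
        ← intervalIntegral.integral_interval_sub_left (hinner s) (hinner r), hφ]
      have h3 : (inner ℂ (∫ v in (r : ℝ)..s, k v) (x s + x r)).re
          = -(inner ℂ (x s - x r) (x s + x r)).re := by
        rw [hsub r s htr hrs hsb, inner_neg_left, Complex.neg_re, neg_neg]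
      rw [h3, ← h1]
      ring
    rw [h2, ← Real.norm_eq_abs]
    have h4 : 2 * (A s - A r) ^ 2 = ∫ v in (r : ℝ)..s, ‖k v‖ * (2 * (A s - A r)) := by
      rw [intervalIntegral.integral_mul_const, ← hAsub]
      ring
    rw [h4]
    refine intervalIntegral.norm_integral_le_of_norm_le hrs (Eventually.of_forall fun v hv => ?_)
      ((hki.intervalIntegrable r s).mul_const _)
    have hv0 : 0 ≤ v := r.coe_nonneg.trans hv.1.le
    have hv1 : r ≤ v.toNNReal := Real.le_toNNReal_iff_coe_le hv0 |>.2 hv.1.le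
    have hv2 : v.toNNReal ≤ s := Real.toNNReal_le_iff_le_coe.2 hv.2
    -- The error compares `x v` with the two endpoint values, and both differences are controlled by
    -- the increment of `A`.
    have h5 : 2 * (inner ℂ (k v) (x v.toNNReal)).re - (inner ℂ (k v) (x s + x r)).re
        = (inner ℂ (k v) ((x v.toNNReal - x s) + (x v.toNNReal - x r))).re := by
      simp only [inner_add_right, inner_sub_right, Complex.add_re, Complex.sub_re]
      ring
    rw [h5]
    have h6 := hsubA v.toNNReal s (htr.trans hv1) hv2 hsb
    have h7 := hsubA r v.toNNReal htr hv1 (hv2.trans_lt hsb)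
    have h8 := hmono hv1
    have h9 := hmono hv2
    calc _ ≤ ‖inner ℂ (k v) ((x v.toNNReal - x s) + (x v.toNNReal - x r))‖ :=
          Complex.abs_re_le_norm _
      _ ≤ ‖k v‖ * ‖(x v.toNNReal - x s) + (x v.toNNReal - x r)‖ := norm_inner_le_norm _ _
      _ ≤ ‖k v‖ * (2 * (A s - A r)) := by
        gcongr
        refine (norm_add_le _ _).trans ?_
        rw [norm_sub_rev (x v.toNNReal) (x s)]
        linarith
  rw [← intervalIntegral.integral_interval_sub_left (hinner u) (hinner t)]
  have := hφeq
  simp only [hφ] at this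
  linarith

end InnerProduct
/-! ### Pathwise properties of solutions of the linear equation -/

section LinearPath

variable {ι E : Type*} [Fintype ι] [NormedAddCommGroup E] [InnerProductSpace ℂ E]

/-- A path which, at each jump of one of the counting paths `n α`, is multiplied by `M α`, and
between the jumps moves continuously in such a way that the squared norm has derivative
`-∑ α, (‖M α x‖ ^ 2 - ‖x‖ ^ 2)`. -/
structure IsJumpFlow (n : ι → ℝ≥0 → ℕ) (M : ι → E →L[ℂ] E) (x : ℝ≥0 → E) : Prop where
  cadlag : IsCadlag x
  jump : ∀ t, 0 < t → ((∀ α, jumpSize (n α) t = 0) ∧ x t = Function.leftLim x t) ∨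
    ∃ α, jumpSize (n α) t = 1 ∧ (∀ β, β ≠ α → jumpSize (n β) t = 0) ∧
      x t = M α (Function.leftLim x t)
  continuousAt : ∀ t, ∀ᶠ u in 𝓝[>] t, ContinuousAt x u
  norm_sq : ∀ t, ∀ᶠ u in 𝓝[>] t, ‖x u‖ ^ 2 = ‖x t‖ ^ 2
    - ∫ s in (t : ℝ)..u, ∑ α, (‖M α (x s.toNNReal)‖ ^ 2 - ‖x s.toNNReal‖ ^ 2)

theorem LocIntegrable.clm_apply {G : ℝ → E} (hG : LocIntegrable G) (L : E →L[ℂ] E) :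
    LocIntegrable fun s => L (G s) := fun t =>
  ⟨L.integrable_comp (hG t).1, L.integrable_comp (hG t).2⟩

theorem LocIntegrable.const_smul {G : ℝ → E} (hG : LocIntegrable G) (c : ℂ) :
    LocIntegrable fun s => c • G s := fun t =>
  ⟨(hG t).1.smul c, (hG t).2.smul c⟩

variable [CompleteSpace E]

/-- Symmetry makes `⟨H v, v⟩` real. -/
theorem re_inner_I_smul_opValue {H : E →ₗ.[ℂ] E} (hH : IsSelfAdjoint H) {v : E}
    (hv : v ∈ H.domain) : (inner ℂ (Complex.I • opValue H v) v).re = 0 := by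
  have h1 := LinearPMap.adjoint_isFormalAdjoint hH.dense_domain
  rw [LinearPMap.isSelfAdjoint_def.1 hH] at h1
  have h2 := h1 ⟨v, hv⟩ ⟨v, hv⟩
  have h3 : opValue H v = H ⟨v, hv⟩ := dif_pos hv
  rw [h3, inner_smul_left]
  have h4 : (inner ℂ (H ⟨v, hv⟩) v).im = 0 := by
    have h5 := inner_im_symm (𝕜 := ℂ) (H ⟨v, hv⟩) v
    have h6 : inner ℂ (H ⟨v, hv⟩) v = inner ℂ v (H ⟨v, hv⟩) := h2
    simp only [RCLike.im_to_complex] at h5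
    rw [← h6] at h5
    linarith
  simp [h4]

/-- Expand `‖L v + v‖²`: the cross term comes from the compensator, and `‖L v‖² = ⟨L† L v, v⟩` from
twice the damping term. -/
theorem two_mul_re_inner_generator {H : E →ₗ.[ℂ] E} (hH : IsSelfAdjoint H)
    {L M : ι → E →L[ℂ] E} (hM : ∀ α, M α = L α + 1) {v : E} (hv : v ∈ H.domain) :
    2 * (inner ℂ (∑ α, L α v + (Complex.I • opValue H v
      + (1 / 2 : ℂ) • ∑ α, (L α).adjoint (L α v))) v).re = ∑ α, (‖M α v‖ ^ 2 - ‖v‖ ^ 2) := by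
  have h1 : ∀ α, ‖M α v‖ ^ 2 - ‖v‖ ^ 2
      = 2 * (inner ℂ (L α v) v).re + (inner ℂ ((L α).adjoint (L α v)) v).re := fun α => by
    have h2 := norm_add_sq (𝕜 := ℂ) (L α v) v
    rw [hM, add_apply, one_apply_eq_self, h2,
      ContinuousLinearMap.adjoint_inner_left]
    have h3 := inner_self_eq_norm_sq (𝕜 := ℂ) (L α v)
    simp only [RCLike.re_to_complex] at h3 ⊢
    rw [h3]
    ring
  rw [inner_add_left, inner_add_left, Complex.add_re, Complex.add_re,
    re_inner_I_smul_opValue hH hv, inner_smul_left, sum_inner, sum_inner, Complex.re_sum,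
    Finset.sum_congr rfl fun α _ => h1 α, Finset.sum_add_distrib, ← Finset.mul_sum]
  have h4 : (starRingEnd ℂ (1 / 2 : ℂ) * ∑ α, inner ℂ ((L α).adjoint (L α v)) v).re
      = (1 / 2) * ∑ α, (inner ℂ ((L α).adjoint (L α v)) v).re := by
    have h5 : starRingEnd ℂ (1 / 2 : ℂ) = ((1 / 2 : ℝ) : ℂ) := by
      rw [show (1 / 2 : ℂ) = ((1 / 2 : ℝ) : ℂ) by push_cast; rfl, Complex.conj_ofReal]
    rw [h5, Complex.re_ofReal_mul, Complex.re_sum]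
  rw [h4]
  ring

theorem isJumpFlow_of_equation {H : E →ₗ.[ℂ] E} (hH : IsSelfAdjoint H)
    {L M : ι → E →L[ℂ] E} (hM : ∀ α, M α = L α + 1) {n : ι → ℝ≥0 → ℕ}
    (hn : ∀ α, IsCountingPath (n α))
    (hjump : ∀ s, 0 < s → (∀ α, jumpSize (n α) s = 0) ∨
      ∃ α, jumpSize (n α) s = 1 ∧ ∀ β, β ≠ α → jumpSize (n β) s = 0)
    {x : ℝ≥0 → E} {c : E} (hx : IsCadlag x)
    (hdom : ∀ᵐ s : ℝ ∂volume, 0 ≤ s → x s.toNNReal ∈ H.domain)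
    (hHx : LocIntegrable fun s => opValue H (x s.toNNReal))
    (heq : ∀ t : ℝ≥0, x t = c
      + ∑ α, compensatedIntegral (n α) (fun s => L α (Function.leftLim x s)) t
      - ∫ s in (0 : ℝ)..t, (Complex.I • opValue H (x s.toNNReal)
          + (1 / 2 : ℂ) • ∑ α, (L α).adjoint (L α (x s.toNNReal)))) :
    IsJumpFlow n M x := by
  have hg : ∀ α, LocIntegrable fun s => L α (Function.leftLim x s.toNNReal) :=
    fun α => hx.locIntegrable_leftLim.clm_apply (L α)
  have hh : LocIntegrable fun s => Complex.I • opValue H (x s.toNNReal)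
      + (1 / 2 : ℂ) • ∑ α, (L α).adjoint (L α (x s.toNNReal)) :=
    (hHx.const_smul _).add ((LocIntegrable.sum fun α =>
      (hx.locIntegrable.clm_apply (L α)).clm_apply (L α).adjoint).const_smul _)
  have hev : EvolvesBy n (fun α s => L α (Function.leftLim x s)) _ x :=
    evolvesBy_of_equation hn hg hh heq
  have hcont := hev.eventually_continuousAt hg hh
  refine ⟨hx, fun t ht => ?_, hcont, fun t => ?_⟩
  · have := NNReal.neBot_nhdsLT ht
    have h1 := tendsto_nhds_unique (hx.tendsto_leftLim t) (hev.jump t ht)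
    rw [eq_sub_iff_add_eq] at h1
    rcases hjump t ht with h | ⟨α, hα, hβ⟩
    · refine Or.inl ⟨h, ?_⟩
      rw [← h1, Finset.sum_eq_zero fun α _ => by rw [h α, zero_smul], add_zero]
    · refine Or.inr ⟨α, hα, hβ, ?_⟩
      rw [← h1, Finset.sum_eq_single α (fun β _ hne => by rw [hβ β hne, zero_smul])
        (fun h => absurd (Finset.mem_univ α) h), hα, one_smul, hM,
        add_apply, one_apply_eq_self, add_comm]
  -- The stochastic integrand contains left limits; almost everywhere they equal the values.
  · have hae : ∀ᵐ s : ℝ ∂volume, 0 ≤ s → ContinuousAt x s.toNNReal :=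
      NNReal.ae_toNNReal_of_eventually_nhdsGT hcont
    have hk := (LocIntegrable.sum fun α => hx.locIntegrable.clm_apply (L α)).add hh
    obtain ⟨b, hb, hb'⟩ := (mem_nhdsGT_iff_exists_Ioo_subset).1 (hev.flow t)
    filter_upwards [Ioo_mem_nhdsGT hb] with u hu
    have h1 : ∀ r, t ≤ r → r < b → x r = x t - ∫ s in (t : ℝ)..r, (∑ α, L α (x s.toNNReal)
        + (Complex.I • opValue H (x s.toNNReal)
          + (1 / 2 : ℂ) • ∑ α, (L α).adjoint (L α (x s.toNNReal)))) := by
      intro r htr hrb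
      rcases htr.eq_or_lt with rfl | htr
      · simp
      · rw [hb' ⟨htr, hrb⟩]
        congr 1
        refine intervalIntegral_congr_nonneg ?_ t r
        filter_upwards [hae] with s hs h0
        rw [(hs h0).leftLim_eq]
    rw [norm_sq_eq_sub_integral hx hk h1 hu.1.le hu.2]
    congr 1
    refine intervalIntegral_congr_nonneg ?_ t u
    filter_upwards [hdom] with s hs h0
    exact two_mul_re_inner_generator hH hM (hs h0)

end LinearPath
/-! ### The Doléans-Dade equation along a path -/

theorem NNReal.eventually_nhds_of_nhdsGT {p : ℝ≥0 → Prop} {t : ℝ≥0} (h : ∀ᶠ u in 𝓝[>] t, p u) :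
    ∀ᶠ u in 𝓝[>] t, ∀ᶠ r in 𝓝 u, p r := by
  filter_upwards [eventually_eventually_nhdsWithin.2 h, self_mem_nhdsWithin] with u hu htu
  rwa [isOpen_Ioi.nhdsWithin_eq htu] at hu

/-- A local Grönwall lemma: on a short interval each pass through the equation halves the bound on
`D`. The hypothesis on `K` uses bounds over an interval, so that `K` may involve left limits. -/
theorem eventually_eq_zero_of_eq_integral {D : ℝ≥0 → ℝ} {K : ℝ → ℝ} {t : ℝ≥0} {C : ℝ}
    (hC : 0 ≤ C) (hD : ∀ᶠ u in 𝓝[>] t, |D u| ≤ 1)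
    (heq : ∀ᶠ u in 𝓝[>] t, D u = ∫ s in (t : ℝ)..u, K s)
    (hK : ∀ b B, (∀ r ∈ Ioo t b, |D r| ≤ B) → ∀ s ∈ Ioo t b, |K s| ≤ C * B) :
    ∀ᶠ u in 𝓝[>] t, D u = 0 := by
  obtain ⟨b₀, hb₀, hb⟩ := (mem_nhdsGT_iff_exists_Ioo_subset).1 (hD.and heq)
  -- Chosen so that `C δ ≤ 1 / 2`, also when `C = 0`.
  set δ : ℝ≥0 := (1 / (2 * (C + 1))).toNNReal with hδ
  have hδ' : (δ : ℝ) = 1 / (2 * (C + 1)) := Real.coe_toNNReal _ (by positivity)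
  have hδ0 : 0 < δ := Real.toNNReal_pos.2 (by positivity)
  have hb1 : t < min b₀ (t + δ) := lt_min hb₀ (lt_add_of_pos_right t hδ0)
  have key : ∀ k : ℕ, ∀ u ∈ Ioo t (min b₀ (t + δ)), |D u| ≤ (1 / 2) ^ k := by
    intro k
    induction k with
    | zero =>
      intro u hu
      simpa using (hb ⟨hu.1, hu.2.trans_le (min_le_left _ _)⟩).1
    | succ k ih =>
      intro u hu
      rw [(hb ⟨hu.1, hu.2.trans_le (min_le_left _ _)⟩).2, ← Real.norm_eq_abs]
      have h1 : ∀ s ∈ uIoc (t : ℝ) u, ‖K s‖ ≤ C * (1 / 2) ^ k := by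
        intro s hs
        rw [uIoc_of_le (NNReal.coe_le_coe.2 hu.1.le)] at hs
        have hs0 : 0 ≤ s := t.coe_nonneg.trans hs.1.le
        lift s to ℝ≥0 using hs0
        exact hK _ _ ih s ⟨NNReal.coe_lt_coe.1 hs.1, (NNReal.coe_le_coe.1 hs.2).trans_lt hu.2⟩
      refine (intervalIntegral.norm_integral_le_of_norm_le_const h1).trans ?_
      have h2 : (u : ℝ) < t + δ := by exact_mod_cast hu.2.trans_le (min_le_right _ _)
      have h3 : (t : ℝ) < u := NNReal.coe_lt_coe.2 hu.1
      rw [abs_of_pos (sub_pos.2 h3), pow_succ]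
      have h4 : C * ((u : ℝ) - t) ≤ 1 / 2 := by
        have h5 : C * ((u : ℝ) - t) ≤ C * (1 / (2 * (C + 1))) := by
          gcongr
          linarith
        have h6 : C * (1 / (2 * (C + 1))) ≤ 1 / 2 := by
          rw [mul_one_div, div_le_div_iff₀ (by positivity) (by norm_num)]
          linarith
        linarith
      have h7 : (0 : ℝ) ≤ (1 / 2) ^ k := by positivity
      nlinarith
  filter_upwards [Ioo_mem_nhdsGT hb1] with u hu
  have h1 := ge_of_tendsto' (tendsto_pow_atTop_nhds_zero_of_lt_one
    (by norm_num : (0 : ℝ) ≤ 1 / 2) (by norm_num)) fun k => key k u hu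
  exact abs_nonpos_iff.1 h1

/-- Here the integrand depends on the solution, so `EvolvesBy.unique` is not enough. At `t` equal
left limits give equal jumps; to the right, Grönwall is applied to `y - z`. -/
theorem EvolvesBy.doleansDade_unique {ι : Type*} [Fintype ι] {n : ι → ℝ≥0 → ℕ}
    {f : ι → ℝ≥0 → ℝ} {C : ℝ} (hf : ∀ α s, |f α s| ≤ C) {y z : ℝ≥0 → ℝ} (hyc : IsCadlag y)
    (hzc : IsCadlag z)
    (hyi : ∀ α, LocIntegrable fun s => Function.leftLim y s.toNNReal * f α s.toNNReal)
    (hzi : ∀ α, LocIntegrable fun s => Function.leftLim z s.toNNReal * f α s.toNNReal)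
    (hy : EvolvesBy n (fun α s => Function.leftLim y s * f α s) 0 y)
    (hz : EvolvesBy n (fun α s => Function.leftLim z s * f α s) 0 z) (h0 : y 0 = z 0)
    (t : ℝ≥0) : y t = z t := by
  induction t using NNReal.continuous_induction with
  | left t ih =>
    rcases eq_zero_or_pos t with rfl | ht
    · exact h0
    · have := NNReal.neBot_nhdsLT ht
      have hyz : y =ᶠ[𝓝[<] t] z := by
        filter_upwards [self_mem_nhdsWithin] with s hs using ih s hs
      have h1 : Function.leftLim y t = Function.leftLim z t :=
        tendsto_nhds_unique ((hyc.tendsto_leftLim t).congr' hyz) (hzc.tendsto_leftLim t)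
      have h2 := tendsto_nhds_unique ((hy.jump t ht).congr' hyz) (hz.jump t ht)
      simp only [h1] at h2
      exact sub_left_injective h2
  | right t ih =>
    have hyt : y t = z t := ih t le_rfl
    have hC : 0 ≤ (Fintype.card ι : ℝ) * |C| := by positivity
    have hlim : Tendsto (fun u => |y u - z u|) (𝓝[>] t) (𝓝 |y t - z t|) :=
      (((hyc t).1.mono Ioi_subset_Ici_self).tendsto.sub
        ((hzc t).1.mono Ioi_subset_Ici_self).tendsto).abs
    have h1 := eventually_eq_zero_of_eq_integral (D := fun u => y u - z u)
      (K := fun s => -∑ α, (Function.leftLim y s.toNNReal * f α s.toNNReal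
        - Function.leftLim z s.toNNReal * f α s.toNNReal)) (t := t) hC ?_ ?_ ?_
    · filter_upwards [h1] with u hu using sub_eq_zero.1 hu
    · exact (hlim.eventually_lt_const (by simp [hyt])).mono fun u hu => le_of_lt hu
    · filter_upwards [hy.flow t, hz.flow t] with u hu hu'
      rw [hu, hu', hyt]
      simp only [Pi.zero_apply, add_zero, Finset.sum_sub_distrib]
      rw [intervalIntegral.integral_neg, intervalIntegral.integral_sub
        ((LocIntegrable.sum hyi).intervalIntegrable t u)
        ((LocIntegrable.sum hzi).intervalIntegrable t u)]
      ring
    · intro b B hB s hs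
      have := NNReal.neBot_nhdsLT (zero_le.trans_lt hs.1)
      have h2 : |Function.leftLim y s - Function.leftLim z s| ≤ B := by
        refine le_of_tendsto ((hyc.tendsto_leftLim s).sub (hzc.tendsto_leftLim s)).abs ?_
        filter_upwards [Ioo_mem_nhdsLT hs.1] with r hr
        exact hB r ⟨hr.1, hr.2.trans hs.2⟩
      rw [abs_neg, Real.toNNReal_coe]
      refine (Finset.abs_sum_le_sum_abs _ _).trans ?_
      rw [mul_assoc, ← nsmul_eq_mul, ← Finset.card_univ]
      refine Finset.sum_le_card_nsmul _ _ _ fun α _ => ?_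
      rw [← sub_mul, abs_mul, mul_comm]
      exact mul_le_mul ((hf α s).trans (le_abs_self C)) h2 (abs_nonneg _) (abs_nonneg _)

section NormRatio

variable {E : Type*} [NormedAddCommGroup E] [InnerProductSpace ℂ E]

/-- The norm of `M` applied to the normalization of `v`, with value `0` at `v = 0`. -/
noncomputable def normRatio (M : E →L[ℂ] E) (v : E) : ℝ := ‖M v‖ / ‖v‖

theorem normRatio_nonneg (M : E →L[ℂ] E) (v : E) : 0 ≤ normRatio M v := by
  unfold normRatio; positivity

theorem normRatio_le (M : E →L[ℂ] E) (v : E) : normRatio M v ≤ ‖M‖ := M.ratio_le_opNorm v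

theorem abs_normRatio_sub_one_le (M : E →L[ℂ] E) (v : E) : |normRatio M v - 1| ≤ ‖M‖ + 1 := by
  have h1 := normRatio_nonneg M v
  have h2 := normRatio_le M v
  have h3 := norm_nonneg M
  exact abs_le.2 ⟨by linarith, by linarith⟩

theorem sq_normRatio_sub_one_le (M : E →L[ℂ] E) (v : E) :
    (normRatio M v - 1) ^ 2 ≤ (‖M‖ + 1) ^ 2 := by
  rw [← sq_abs]
  exact pow_le_pow_left₀ (abs_nonneg _) (abs_normRatio_sub_one_le M v) 2

theorem abs_leftLim_normRatio_sub_one_le (M : E →L[ℂ] E) (x : ℝ≥0 → E) (t : ℝ≥0) :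
    |Function.leftLim (fun r => normRatio M (x r)) t - 1| ≤ ‖M‖ + 1 := by
  have h := leftLim_mem_of_isClosed (x := fun r => normRatio M (x r)) (s := Icc 0 ‖M‖)
    isClosed_Icc (fun r => ⟨normRatio_nonneg M _, normRatio_le M _⟩) t
  have h3 := norm_nonneg M
  exact abs_le.2 ⟨by linarith [h.1], by linarith [h.2]⟩

theorem continuousAt_normRatio (M : E →L[ℂ] E) {v : E} (hv : v ≠ 0) :
    ContinuousAt (normRatio M) v :=
  (M.continuous.norm.continuousAt).div continuous_norm.continuousAt (norm_ne_zero_iff.2 hv)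

theorem MeasureTheory.StronglyMeasurable.normRatio {Ω : Type*} [MeasurableSpace Ω] {y : Ω → E}
    (hy : StronglyMeasurable y) (M : E →L[ℂ] E) :
    StronglyMeasurable fun ω => normRatio M (y ω) :=
  ((M.continuous.comp_stronglyMeasurable hy).norm.measurable.div
    hy.norm.measurable).stronglyMeasurable

end NormRatio

section DensityPath

variable {ι E : Type*} [Fintype ι] [NormedAddCommGroup E] [InnerProductSpace ℂ E]

/-- Half the accumulated squared fluctuation `∑_α ∫_0^t (‖M_α Ψ_s‖ - 1)^2 ds` of a path. -/
noncomputable def stateExponent (M : ι → E →L[ℂ] E) (x : ℝ≥0 → E) (t : ℝ) : ℝ :=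
  1 / 2 * ∑ α, ∫ s in (0 : ℝ)..t, (normRatio (M α) (x s.toNNReal) - 1) ^ 2

/-- The norm of a path, corrected by the exponential of the accumulated squared fluctuation. -/
noncomputable def densityPath (M : ι → E →L[ℂ] E) (x : ℝ≥0 → E) (t : ℝ≥0) : ℝ :=
  ‖x t‖ * Real.exp (stateExponent M x t)

variable {M : ι → E →L[ℂ] E} {x : ℝ≥0 → E}

theorem stronglyMeasurable_normRatio_path (hx : IsCadlag x) (M : E →L[ℂ] E) :
    StronglyMeasurable fun s : ℝ => normRatio M (x s.toNNReal) :=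
  (hx.stronglyMeasurable.comp_measurable measurable_real_toNNReal).normRatio M

theorem locIntegrable_sq_normRatio_sub_one (hx : IsCadlag x) (M : E →L[ℂ] E) :
    LocIntegrable fun s => (normRatio M (x s.toNNReal) - 1) ^ 2 :=
  .of_bound (((stronglyMeasurable_normRatio_path hx M).sub
    stronglyMeasurable_const).pow 2).aestronglyMeasurable fun _ =>
    ⟨(‖M‖ + 1) ^ 2, fun s _ _ => by
      rw [Real.norm_of_nonneg (sq_nonneg _)]
      exact sq_normRatio_sub_one_le M _⟩

theorem continuous_stateExponent (hx : IsCadlag x) :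
    Continuous fun t : ℝ≥0 => stateExponent M x t :=
  (continuous_finsetSum _ fun α _ =>
    (locIntegrable_sq_normRatio_sub_one hx (M α)).continuous_primitive).const_mul _

theorem isCadlag_densityPath (hx : IsCadlag x) : IsCadlag (densityPath M x) := fun t => by
  have hc : Continuous fun t : ℝ≥0 => Real.exp (stateExponent M x t) :=
    Real.continuous_exp.comp (continuous_stateExponent hx)
  refine ⟨(hx t).1.norm.mul hc.continuousWithinAt, ?_⟩
  obtain ⟨l, hl⟩ := (hx t).2
  exact ⟨_, hl.norm.mul ((hc.tendsto t).mono_left nhdsWithin_le_nhds)⟩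

theorem locIntegrable_mul_normRatio_sub_one {z : ℝ≥0 → ℝ} (hz : IsCadlag z) (hx : IsCadlag x)
    (M : E →L[ℂ] E) :
    LocIntegrable fun s => z s.toNNReal * (normRatio M (x s.toNNReal) - 1) :=
  .of_bound ((hz.stronglyMeasurable.comp_measurable measurable_real_toNNReal).mul
    ((stronglyMeasurable_normRatio_path hx M).sub stronglyMeasurable_const)).aestronglyMeasurable
    fun t => by
      obtain ⟨B, hB⟩ := hz.exists_bound t
      refine ⟨B * (‖M‖ + 1), fun s _ hs => ?_⟩
      rw [norm_mul]
      have h1 := hB _ (Real.toNNReal_le_iff_le_coe.2 hs)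
      exact mul_le_mul h1 (abs_normRatio_sub_one_le M _) (norm_nonneg _) ((norm_nonneg _).trans h1)

namespace IsJumpFlow

variable {n : ι → ℝ≥0 → ℕ}

/-- Grönwall for `‖x‖²`, whose rate of change is at most a constant times `‖x‖²`. -/
theorem eventually_eq_zero (hx : IsJumpFlow n M x) {t : ℝ≥0} (ht : x t = 0) :
    ∀ᶠ u in 𝓝[>] t, x u = 0 := by
  have h1 := eventually_eq_zero_of_eq_integral (D := fun u => ‖x u‖ ^ 2)
    (K := fun s => -∑ α, (‖M α (x s.toNNReal)‖ ^ 2 - ‖x s.toNNReal‖ ^ 2)) (t := t)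
    (C := ∑ α, (‖M α‖ ^ 2 + 1)) (Finset.sum_nonneg fun α _ => by positivity) ?_ ?_ ?_
  · filter_upwards [h1] with u hu
    simpa using hu
  · have h2 : Tendsto (fun u => |‖x u‖ ^ 2|) (𝓝[>] t) (𝓝 |‖x t‖ ^ 2|) :=
      (((hx.cadlag t).1.mono Ioi_subset_Ici_self).tendsto.norm.pow 2).abs
    exact (h2.eventually_lt_const (by simp [ht])).mono fun u hu => le_of_lt hu
  · filter_upwards [hx.norm_sq t] with u hu
    rw [hu, ht, intervalIntegral.integral_neg]
    simp
  · intro b B hB s hs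
    rw [abs_neg, Real.toNNReal_coe, Finset.sum_mul]
    refine (Finset.abs_sum_le_sum_abs _ _).trans (Finset.sum_le_sum fun α _ => ?_)
    have h2 := hB s hs
    rw [abs_of_nonneg (sq_nonneg _)] at h2
    have h3 : ‖M α (x s)‖ ^ 2 ≤ ‖M α‖ ^ 2 * ‖x s‖ ^ 2 := by
      rw [← mul_pow]
      exact pow_le_pow_left₀ (norm_nonneg _) ((M α).le_opNorm _) 2
    have h4 : ‖M α‖ ^ 2 * ‖x s‖ ^ 2 ≤ ‖M α‖ ^ 2 * B := by gcongr
    have h5 := sq_nonneg ‖M α (x s)‖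
    have h6 := sq_nonneg ‖x s‖
    have h7 : 0 ≤ ‖M α‖ ^ 2 * ‖x s‖ ^ 2 := by positivity
    exact abs_le.2 ⟨by nlinarith, by nlinarith⟩

theorem eventually_ne_zero (hx : IsJumpFlow n M x) {t : ℝ≥0} (ht : x t ≠ 0) :
    ∀ᶠ u in 𝓝[>] t, x u ≠ 0 :=
  ((hx.cadlag t).1.mono Ioi_subset_Ici_self).tendsto.eventually_ne ht

theorem eventually_continuousAt_normRatio (hx : IsJumpFlow n M x) (α : ι) (t : ℝ≥0) :
    ∀ᶠ u in 𝓝[>] t, ContinuousAt (fun r => normRatio (M α) (x r)) u := by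
  by_cases ht : x t = 0
  · filter_upwards [NNReal.eventually_nhds_of_nhdsGT (hx.eventually_eq_zero ht)] with u hu
    have h : (fun r => normRatio (M α) (x r)) =ᶠ[𝓝 u] fun _ => normRatio (M α) 0 := by
      filter_upwards [hu] with r hr
      rw [hr]
    exact (continuousAt_congr h).2 continuousAt_const
  · filter_upwards [hx.eventually_ne_zero ht, hx.continuousAt t] with u hu hu'
    exact (continuousAt_normRatio (M α) hu).comp' hu'

theorem ae_leftLim_normRatio (hx : IsJumpFlow n M x) : ∀ᵐ s : ℝ ∂volume, 0 ≤ s → ∀ α,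
    Function.leftLim (fun r => normRatio (M α) (x r)) s.toNNReal
      = normRatio (M α) (x s.toNNReal) := by
  have h : ∀ t, ∀ᶠ u in 𝓝[>] t, ∀ α,
      Function.leftLim (fun r => normRatio (M α) (x r)) u = normRatio (M α) (x u) := fun t =>
    eventually_all.2 fun α =>
      (hx.eventually_continuousAt_normRatio α t).mono fun u hu => hu.leftLim_eq
  exact NNReal.ae_toNNReal_of_eventually_nhdsGT h

theorem eventually_continuousAt_densityPath (hx : IsJumpFlow n M x) (t : ℝ≥0) :
    ∀ᶠ u in 𝓝[>] t, ContinuousAt (densityPath M x) u :=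
  (hx.continuousAt t).mono fun _ hu => hu.norm.mul
    (Real.continuous_exp.comp (continuous_stateExponent hx.cadlag)).continuousAt

theorem ae_leftLim_densityPath (hx : IsJumpFlow n M x) : ∀ᵐ s : ℝ ∂volume, 0 ≤ s →
    Function.leftLim (densityPath M x) s.toNNReal = densityPath M x s.toNNReal := by
  have h : ∀ t, ∀ᶠ u in 𝓝[>] t, Function.leftLim (densityPath M x) u = densityPath M x u := fun t =>
    (hx.eventually_continuousAt_densityPath t).mono fun u hu => hu.leftLim_eq
  exact NNReal.ae_toNNReal_of_eventually_nhdsGT h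

theorem hasDerivAt_stateExponent (hx : IsJumpFlow n M x) {s : ℝ} (hs : 0 < s)
    (hne : x s.toNNReal ≠ 0) (hc : ContinuousAt x s.toNNReal) :
    HasDerivAt (stateExponent M x)
      (1 / 2 * ∑ α, (normRatio (M α) (x s.toNNReal) - 1) ^ 2) s := by
  refine (HasDerivAt.fun_sum fun α _ => ?_).const_mul _
  have hi := locIntegrable_sq_normRatio_sub_one hx.cadlag (M α) s.toNNReal
  rw [Real.coe_toNNReal s hs.le] at hi
  refine intervalIntegral.integral_hasDerivAt_right hi
    (((stronglyMeasurable_normRatio_path hx.cadlag (M α)).sub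
      stronglyMeasurable_const).pow 2).stronglyMeasurableAtFilter ?_
  have h1 : ContinuousAt (fun r : ℝ => x r.toNNReal) s :=
    ContinuousAt.comp' (f := Real.toNNReal) hc continuous_real_toNNReal.continuousAt
  exact ((ContinuousAt.comp' (f := fun r : ℝ => x r.toNNReal)
    (continuousAt_normRatio (M α) hne) h1).sub continuousAt_const).pow 2

/-- Although `x` need not be differentiable, `‖x‖²` is: its integrand no longer contains `H` and is
continuous wherever `x` is. -/
theorem hasDerivAt_densityPath (hx : IsJumpFlow n M x) {t b : ℝ≥0}
    (hsq : ∀ u ∈ Ioo t b, ‖x u‖ ^ 2 = ‖x t‖ ^ 2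
      - ∫ s in (t : ℝ)..u, ∑ α, (‖M α (x s.toNNReal)‖ ^ 2 - ‖x s.toNNReal‖ ^ 2))
    {s : ℝ≥0} (hs : s ∈ Ioo t b) (hne : x s ≠ 0) (hc : ContinuousAt x s) :
    HasDerivAt (fun r : ℝ => densityPath M x r.toNNReal)
      (-∑ α, densityPath M x s * (normRatio (M α) (x s) - 1)) s := by
  have hs0 : (0 : ℝ) < s := NNReal.coe_pos.2 (zero_le.trans_lt hs.1)
  have hcr : ContinuousAt (fun r : ℝ => x r.toNNReal) s :=
    ContinuousAt.comp' (f := Real.toNNReal) (by rwa [Real.toNNReal_coe])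
      continuous_real_toNNReal.continuousAt
  have hW := hx.hasDerivAt_stateExponent hs0 (by rwa [Real.toNNReal_coe])
    (by rwa [Real.toNNReal_coe])
  rw [Real.toNNReal_coe] at hW
  have hxm := hx.cadlag.stronglyMeasurable.comp_measurable measurable_real_toNNReal
  have hint : LocIntegrable fun s : ℝ =>
      ∑ α, (‖M α (x s.toNNReal)‖ ^ 2 - ‖x s.toNNReal‖ ^ 2) := by
    refine LocIntegrable.sum fun α => .of_bound ?_ fun t => ?_
    · exact ((((M α).continuous.comp_stronglyMeasurable hxm).norm.pow 2).sub
        (hxm.norm.pow 2)).aestronglyMeasurable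
    · obtain ⟨B, hB⟩ := hx.cadlag.exists_bound t
      refine ⟨(‖M α‖ * B) ^ 2 + B ^ 2, fun s _ hs => (norm_sub_le _ _).trans ?_⟩
      have h1 := hB _ (Real.toNNReal_le_iff_le_coe.2 hs)
      rw [norm_pow, norm_pow, norm_norm, norm_norm]
      gcongr
      exact (M α).le_opNorm_of_le h1
  have hmeas : StronglyMeasurable fun s : ℝ =>
      ∑ α, (‖M α (x s.toNNReal)‖ ^ 2 - ‖x s.toNNReal‖ ^ 2) :=
    Finset.stronglyMeasurable_fun_sum _ fun α _ =>
      (((M α).continuous.comp_stronglyMeasurable hxm).norm.pow 2).sub (hxm.norm.pow 2)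
  have hp : HasDerivAt (fun r : ℝ =>
      ∫ s in (t : ℝ)..r, ∑ α, (‖M α (x s.toNNReal)‖ ^ 2 - ‖x s.toNNReal‖ ^ 2))
      (∑ α, (‖M α (x s)‖ ^ 2 - ‖x s‖ ^ 2)) s := by
    have h1 := intervalIntegral.integral_hasDerivAt_right (hint.intervalIntegrable t s)
      hmeas.stronglyMeasurableAtFilter (tendsto_finsetSum _ fun α _ =>
        (((M α).continuous.continuousAt.comp' hcr).norm.pow 2).sub (hcr.norm.pow 2))
    simpa using h1
  have hq : HasDerivAt (fun r : ℝ => ‖x r.toNNReal‖ ^ 2)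
      (-∑ α, (‖M α (x s)‖ ^ 2 - ‖x s‖ ^ 2)) s := by
    refine (hp.const_sub (‖x t‖ ^ 2)).congr_of_eventuallyEq ?_
    filter_upwards [Ioo_mem_nhds (NNReal.coe_lt_coe.2 hs.1) (NNReal.coe_lt_coe.2 hs.2)] with r hr
    lift r to ℝ≥0 using t.coe_nonneg.trans hr.1.le
    rw [Real.toNNReal_coe]
    exact hsq r ⟨NNReal.coe_lt_coe.1 hr.1, NNReal.coe_lt_coe.1 hr.2⟩
  have hpos : 0 < ‖x s‖ := norm_pos_iff.2 hne
  have hφ := hq.sqrt (by simp [hne])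
  simp only [Real.sqrt_sq (norm_nonneg _), Real.toNNReal_coe] at hφ
  have hZ := hφ.mul hW.exp
  have heq : (fun r : ℝ => densityPath M x r.toNNReal)
      =ᶠ[𝓝 (s : ℝ)] fun r => ‖x r.toNNReal‖ * Real.exp (stateExponent M x r) := by
    filter_upwards [lt_mem_nhds hs0] with r hr
    rw [densityPath, Real.coe_toNNReal r hr.le]
  refine (hZ.congr_of_eventuallyEq heq).congr_deriv ?_
  rw [Real.toNNReal_coe, ← Finset.mul_sum]
  -- This is `r² - 1 = (r - 1)² + 2 (r - 1)`; the derivative of the exponent cancels the squares.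
  have h1 : ∑ α, (‖M α (x s)‖ ^ 2 - ‖x s‖ ^ 2)
      = ‖x s‖ ^ 2 * (∑ α, (normRatio (M α) (x s) - 1) ^ 2
        + 2 * ∑ α, (normRatio (M α) (x s) - 1)) := by
    rw [Finset.mul_sum, ← Finset.sum_add_distrib, Finset.mul_sum]
    refine Finset.sum_congr rfl fun α _ => ?_
    rw [normRatio]
    field_simp
    ring
  rw [h1, densityPath]
  field_simp
  ring

theorem densityPath_flow (hx : IsJumpFlow n M x) (t : ℝ≥0) :
    ∀ᶠ u in 𝓝[>] t, densityPath M x u = densityPath M x t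
      - ∫ s in (t : ℝ)..u, ∑ α, densityPath M x s.toNNReal
        * (normRatio (M α) (x s.toNNReal) - 1) := by
  by_cases ht : x t = 0
  · obtain ⟨b, hb, hb'⟩ := (mem_nhdsGT_iff_exists_Ioo_subset).1 (hx.eventually_eq_zero ht)
    filter_upwards [Ioo_mem_nhdsGT hb] with u hu
    have h0 : ∀ r ∈ Ioo t b, densityPath M x r = 0 := fun r hr => by
      have : x r = 0 := hb' hr
      simp [densityPath, this]
    have h1 : ∫ s in (t : ℝ)..u, ∑ α, densityPath M x s.toNNReal
        * (normRatio (M α) (x s.toNNReal) - 1) = 0 := by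
      refine intervalIntegral.integral_zero_ae (Eventually.of_forall fun s hs => ?_)
      rw [uIoc_of_le (NNReal.coe_le_coe.2 hu.1.le)] at hs
      lift s to ℝ≥0 using t.coe_nonneg.trans hs.1.le
      rw [Real.toNNReal_coe, h0 s
        ⟨NNReal.coe_lt_coe.1 hs.1, (NNReal.coe_le_coe.1 hs.2).trans_lt hu.2⟩]
      simp
    rw [h1, h0 u hu, densityPath, ht]
    simp
  · obtain ⟨b, hb, hb'⟩ := (mem_nhdsGT_iff_exists_Ioo_subset).1
      ((hx.eventually_ne_zero ht).and ((hx.continuousAt t).and (hx.norm_sq t)))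
    filter_upwards [Ioo_mem_nhdsGT hb] with u hu
    have htu : (t : ℝ) ≤ u := NNReal.coe_le_coe.2 hu.1.le
    have hcad := isCadlag_densityPath (M := M) hx.cadlag
    have hderiv : ∀ s ∈ Ioo (t : ℝ) u, HasDerivAt (fun r : ℝ => densityPath M x r.toNNReal)
        (-∑ α, densityPath M x s.toNNReal * (normRatio (M α) (x s.toNNReal) - 1)) s := by
      intro s hs
      lift s to ℝ≥0 using t.coe_nonneg.trans hs.1.le
      have hs' : s ∈ Ioo t b := ⟨NNReal.coe_lt_coe.1 hs.1, (NNReal.coe_lt_coe.1 hs.2).trans hu.2⟩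
      rw [Real.toNNReal_coe]
      exact hx.hasDerivAt_densityPath (fun r hr => (hb' hr).2.2) hs' (hb' hs').1 (hb' hs').2.1
    have hcont : ContinuousOn (fun r : ℝ => densityPath M x r.toNNReal) (Icc (t : ℝ) u) := by
      intro s hs
      lift s to ℝ≥0 using t.coe_nonneg.trans hs.1
      -- The path may jump at `t`, so only right continuity is available at this endpoint.
      rcases (NNReal.coe_le_coe.1 hs.1).eq_or_lt with rfl | hts
      · refine ContinuousWithinAt.comp (g := densityPath M x) (f := Real.toNNReal) (t := Ici t) ?_
          continuous_real_toNNReal.continuousWithinAt fun r hr => ?_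
        · rw [Real.toNNReal_coe]
          exact (hcad t).1
        · exact (Real.le_toNNReal_iff_coe_le (t.coe_nonneg.trans hr.1)).2 hr.1
      · have hs' : s ∈ Ioo t b := ⟨hts, (NNReal.coe_le_coe.1 hs.2).trans_lt hu.2⟩
        exact (hx.hasDerivAt_densityPath (fun r hr => (hb' hr).2.2) hs' (hb' hs').1
          (hb' hs').2.1).continuousAt.continuousWithinAt
    have hint := (LocIntegrable.sum fun α =>
      locIntegrable_mul_normRatio_sub_one hcad hx.cadlag (M α)).intervalIntegrable t u
    have h1 := intervalIntegral.integral_eq_sub_of_hasDerivAt_of_le htu hcont hderiv hint.neg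
    rw [intervalIntegral.integral_neg, Real.toNNReal_coe, Real.toNNReal_coe] at h1
    linarith

theorem densityPath_jump (hx : IsJumpFlow n M x) {t : ℝ≥0} (ht : 0 < t) :
    densityPath M x t = Function.leftLim (densityPath M x) t
      + ∑ α, jumpSize (n α) t • (Function.leftLim (densityPath M x) t
        * (Function.leftLim (fun r => normRatio (M α) (x r)) t - 1)) := by
  have := NNReal.neBot_nhdsLT ht
  have hl := hx.cadlag.tendsto_leftLim t
  have h1 : Function.leftLim (densityPath M x) t
      = ‖Function.leftLim x t‖ * Real.exp (stateExponent M x t) :=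
    leftLim_eq_of_tendsto (hl.norm.mul (((Real.continuous_exp.comp
      (continuous_stateExponent hx.cadlag)).tendsto t).mono_left nhdsWithin_le_nhds))
  rcases hx.jump t ht with ⟨h, hxt⟩ | ⟨α, hα, hβ, hxt⟩
  · rw [Finset.sum_eq_zero fun α _ => by rw [h α, zero_smul], add_zero, h1, densityPath, hxt]
  · rw [Finset.sum_eq_single α (fun β _ hne => by rw [hβ β hne, zero_smul])
      (fun h => absurd (Finset.mem_univ α) h), hα, one_smul, h1, densityPath, hxt]
    -- If the left limit is zero, the left limit of the ratio is uncontrolled but is multiplied by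
    -- zero.
    by_cases h0 : Function.leftLim x t = 0
    · simp [h0]
    · have h2 : Function.leftLim (fun r => normRatio (M α) (x r)) t
          = normRatio (M α) (Function.leftLim x t) :=
        leftLim_eq_of_tendsto ((continuousAt_normRatio (M α) h0).tendsto.comp hl)
      have h3 := norm_ne_zero_iff.2 h0
      rw [h2, normRatio]
      field_simp
      ring

theorem locIntegrable_leftLim_mul (hx : IsJumpFlow n M x) (α : ι) :
    LocIntegrable fun s => Function.leftLim (densityPath M x) s.toNNReal
      * (Function.leftLim (fun r => normRatio (M α) (x r)) s.toNNReal - 1) := by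
  refine (locIntegrable_mul_normRatio_sub_one (isCadlag_densityPath (M := M) hx.cadlag)
    hx.cadlag (M α)).congr ?_
  filter_upwards [hx.ae_leftLim_densityPath, hx.ae_leftLim_normRatio] with s h1 h2 hs
  rw [h1 hs, h2 hs]

theorem evolvesBy_densityPath (hx : IsJumpFlow n M x) :
    EvolvesBy n (fun α s => Function.leftLim (densityPath M x) s
      * (Function.leftLim (fun r => normRatio (M α) (x r)) s - 1)) 0 (densityPath M x) := by
  refine ⟨fun t ht => ?_, fun t => ?_⟩
  · rw [← eq_sub_iff_add_eq.2 (hx.densityPath_jump ht).symm]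
    exact (isCadlag_densityPath hx.cadlag).tendsto_leftLim t
  · filter_upwards [hx.densityPath_flow t] with u hu
    rw [hu]
    congr 1
    refine intervalIntegral_congr_nonneg ?_ t u
    filter_upwards [hx.ae_leftLim_densityPath, hx.ae_leftLim_normRatio] with s h1 h2 hs
    simp [h1 hs, h2 hs]

end IsJumpFlow

end DensityPath
/-! ### Measurability and the main theorem -/

section Adapted

variable {ι E : Type*} [Fintype ι] [NormedAddCommGroup E] [InnerProductSpace ℂ E]

theorem stronglyMeasurable_stateExponent {Ω : Type*} [MeasurableSpace Ω] (M : ι → E →L[ℂ] E)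
    {y : ℝ≥0 → Ω → E} (hy : ∀ t, StronglyMeasurable (y t))
    (hr : ∀ ω t, ContinuousWithinAt (fun s => y s ω) (Ici t) t) (t : ℝ≥0) :
    StronglyMeasurable fun ω => stateExponent M (fun s => y s ω) t := by
  refine (Finset.stronglyMeasurable_fun_sum _ fun α _ => ?_).const_mul _
  have h1 : StronglyMeasurable fun p : ℝ × Ω => y p.1.toNNReal p.2 :=
    (stronglyMeasurable_uncurry_of_right_continuous hy hr).comp_measurable
      ((measurable_real_toNNReal.comp measurable_fst).prodMk measurable_snd)
  have h2 : StronglyMeasurable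
      (Function.uncurry fun (s : ℝ) (ω : Ω) => (normRatio (M α) (y s.toNNReal ω) - 1) ^ 2) :=
    ((h1.normRatio (M α)).sub stronglyMeasurable_const).pow 2
  simp only [intervalIntegral.integral_of_le t.coe_nonneg]
  exact h2.integral_prod_left

/-- The exponent at `t` sees only the path stopped at `t`, which is measurable for `𝓕 t` at all
times. -/
theorem stronglyAdapted_densityPath {Ω : Type*} {mΩ : MeasurableSpace Ω}
    {𝓕 : Filtration ℝ≥0 mΩ} (M : ι → E →L[ℂ] E) {ψ : ℝ≥0 → Ω → E} (hψ : StronglyAdapted 𝓕 ψ)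
    (hc : ∀ ω, IsCadlag fun t => ψ t ω) :
    StronglyAdapted 𝓕 fun t ω => densityPath M (fun s => ψ s ω) t := fun t => by
  have h1 : ∀ ω, stateExponent M (fun s => ψ s ω) t
      = stateExponent M (fun s => ψ (min s t) ω) t := fun ω => by
    unfold stateExponent
    congr 1
    refine Finset.sum_congr rfl fun α _ => intervalIntegral.integral_congr fun s hs => ?_
    rw [uIcc_of_le t.coe_nonneg] at hs
    simp only [min_eq_left (Real.toNNReal_le_iff_le_coe.2 hs.2)]
  have h2 := @stronglyMeasurable_stateExponent ι E _ _ _ Ω (𝓕 t) M (fun s => ψ (min s t))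
    (fun s => (hψ (min s t)).mono (𝓕.mono (min_le_right _ _)))
    (fun ω s => ContinuousWithinAt.comp (g := fun s => ψ s ω) (f := fun s => min s t)
      (t := Ici (min s t)) (hc ω _).1 (continuous_id.min continuous_const).continuousWithinAt
      fun r hr => min_le_min_right t hr) t
  simp only [densityPath, h1]
  exact (hψ t).norm.mul (Real.continuous_exp.comp_stronglyMeasurable h2)

/-- Only the modulus of `c` matters; at `v = 0` both sides vanish for any `c`, by `0 / 0 = 0`. -/
theorem norm_apply_normalized (M : E →L[ℂ] E) {v : E} {c : ℂ}
    (hc : v ≠ 0 → starRingEnd ℂ c * c = (inner ℂ v v)⁻¹) : ‖M (c • v)‖ = normRatio M v := by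
  rcases eq_or_ne v 0 with rfl | hv
  · simp [normRatio]
  · have h1 := congrArg norm (hc hv)
    rw [norm_mul, RCLike.norm_conj, norm_inv, inner_self_eq_norm_sq_to_K, norm_pow,
      RCLike.norm_ofReal, abs_norm, ← sq, ← inv_pow] at h1
    have h2 := (pow_left_inj₀ (norm_nonneg c) (by positivity) two_ne_zero).1 h1
    rw [map_smul, norm_smul, h2, normRatio, div_eq_inv_mul]

theorem IsJumpFlow.locIntegrable_leftLim_normRatio {n : ι → ℝ≥0 → ℕ} {M : ι → E →L[ℂ] E}
    {x : ℝ≥0 → E} (hx : IsJumpFlow n M x) (α : ι) :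
    LocIntegrable fun s => Function.leftLim (fun r => normRatio (M α) (x r)) s.toNNReal - 1 := by
  have h1 : IsCadlag fun _ : ℝ≥0 => (1 : ℝ) :=
    fun t => ⟨continuousWithinAt_const, 1, tendsto_const_nhds⟩
  refine (locIntegrable_mul_normRatio_sub_one h1 hx.cadlag (M α)).congr ?_
  filter_upwards [hx.ae_leftLim_normRatio] with s h2 hs
  rw [h2 hs, one_mul]

end Adapted

theorem proposition1 {Ω ι E : Type*} [Fintype ι] {mΩ : MeasurableSpace Ω}
    [NormedAddCommGroup E] [InnerProductSpace ℂ E] [CompleteSpace E]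
    (P : Measure Ω) [IsProbabilityMeasure P] (𝓕 : Filtration ℝ≥0 mΩ)
    (N : ι → ℝ≥0 → Ω → ℕ) (hN : IsPoissonFamily 𝓕 P N)
    (H : E →ₗ.[ℂ] E) (hH : IsSelfAdjoint H)
    (L M : ι → E →L[ℂ] E) (hM : ∀ α, M α = L α + 1)
    (φ₀ : E) (hφ₀ : ‖φ₀‖ = 1)
    (ψ : ℝ≥0 → Ω → E) (hψ : IsLinearSolution 𝓕 P N H L φ₀ ψ)
    (Φ : ℝ≥0 → Ω → ℂ)
    (hΦ : ∀ᵐ ω ∂P, ∀ t, ψ t ω ≠ 0 →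
      starRingEnd ℂ (Φ t ω) * Φ t ω = (inner ℂ (ψ t ω) (ψ t ω))⁻¹)
    (Ψ : ℝ≥0 → Ω → E) (hΨ : ∀ t ω, Ψ t ω = Φ t ω • ψ t ω) :
    (∀ᵐ ω ∂P, ∀ (α : ι) (t : ℝ≥0),
      IntervalIntegrable (fun s : ℝ => (‖M α (Ψ s.toNNReal ω)‖ - 1) ^ 2) volume 0 t) ∧
    (∃ Z : ℝ≥0 → Ω → ℝ, IsDoleansDadeExp 𝓕 P N
      (fun α s ω => Function.leftLim (fun r => ‖M α (Ψ r ω)‖) s - 1) Z) ∧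
    (∀ Z : ℝ≥0 → Ω → ℝ, IsDoleansDadeExp 𝓕 P N
      (fun α s ω => Function.leftLim (fun r => ‖M α (Ψ r ω)‖) s - 1) Z →
      ∀ᵐ ω ∂P, ∀ t : ℝ≥0,
        Real.sqrt (inner ℂ (ψ t ω) (ψ t ω)).re =
          Real.exp (-(1 / 2) *
            ∑ α, ∫ s in (0 : ℝ)..t, (‖M α (Ψ s.toNNReal ω)‖ - 1) ^ 2) * Z t ω) := by
  classical
  have hn : ∀ ω α, IsCountingPath fun t => N α t ω := fun ω α => hN.isCountingPath α ω
  have hgood : ∀ᵐ ω ∂P, IsJumpFlow (fun α s => N α s ω) M (fun s => ψ s ω) ∧ ψ 0 ω = φ₀ ∧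
      ∀ α, (fun r => ‖M α (Ψ r ω)‖) = fun r => normRatio (M α) (ψ r ω) := by
    filter_upwards [hN.ae_jumpSize_cases, hψ.mem_domain, hψ.integrable, hψ.equation, hΦ]
      with ω h1 h2 h3 h4 h5
    refine ⟨isJumpFlow_of_equation hH hM (hn ω) h1 (hψ.cadlag ω) h2 h3 h4, ?_, fun α => ?_⟩
    · have h6 := h4 0
      simpa [compensatedIntegral_zero] using h6
    · funext r
      rw [hΨ]
      exact norm_apply_normalized (M α) (h5 r)
  have hzero : ∀ ω, ψ 0 ω = φ₀ → densityPath M (fun s => ψ s ω) 0 = 1 := fun ω h => by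
    simp [densityPath, stateExponent, h, hφ₀]
  refine ⟨?_, ⟨fun t ω => densityPath M (fun s => ψ s ω) t,
    stronglyAdapted_densityPath M hψ.adapted hψ.cadlag,
    fun ω => isCadlag_densityPath (hψ.cadlag ω), ?_, ?_, ?_⟩, ?_⟩
  · filter_upwards [hgood] with ω ⟨hx, _, hr⟩ α
    have h1 := locIntegrable_sq_normRatio_sub_one hx.cadlag (M α)
    have h2 := congrFun (hr α)
    exact fun t => by simpa only [h2] using h1 t
  · filter_upwards [hgood] with ω ⟨hx, _, hr⟩ α
    simp only [hr]
    exact hx.locIntegrable_leftLim_normRatio α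
  · filter_upwards [hgood] with ω ⟨hx, _, hr⟩ α
    simp only [hr]
    exact hx.locIntegrable_leftLim_mul α
  · filter_upwards [hgood] with ω ⟨hx, h0, hr⟩ t
    simp only [hr]
    have h1 := hx.evolvesBy_densityPath.equation (hn ω) hx.locIntegrable_leftLim_mul
      (fun _ => IntervalIntegrable.zero) t
    rw [hzero ω h0] at h1
    simpa using h1
  · intro Z hZ
    filter_upwards [hgood, hZ.integrable, hZ.equation] with ω ⟨hx, h0, hr⟩ hZi hZe t
    simp only [hr] at hZi hZe
    have hZev : EvolvesBy (fun α s => N α s ω) (fun α s => Function.leftLim (fun r => Z r ω) s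
        * (Function.leftLim (fun r => normRatio (M α) (ψ r ω)) s - 1)) 0 (fun r => Z r ω) :=
      evolvesBy_of_equation (hn ω) hZi (fun _ => IntervalIntegrable.zero) (c := 1)
        fun t => by simpa using hZe t
    -- The sum over all `β` serves as one bound for every `α`.
    have hb : ∀ α s, |Function.leftLim (fun r => normRatio (M α) (ψ r ω)) s - 1|
        ≤ ∑ β, (‖M β‖ + 1) := fun α s =>
      (abs_leftLim_normRatio_sub_one_le (M α) _ s).trans
        (Finset.single_le_sum (f := fun β => ‖M β‖ + 1) (fun β _ => by positivity)
          (Finset.mem_univ α))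
    have hZ0 : Z 0 ω = densityPath M (fun s => ψ s ω) 0 := by
      rw [hzero ω h0, hZe 0]
      simp [compensatedIntegral_zero]
    have h1 := hZev.doleansDade_unique hb (hZ.cadlag ω) (isCadlag_densityPath (hψ.cadlag ω)) hZi
      hx.locIntegrable_leftLim_mul hx.evolvesBy_densityPath hZ0 t
    have h2 : Real.sqrt (inner ℂ (ψ t ω) (ψ t ω)).re = ‖ψ t ω‖ :=
      (norm_eq_sqrt_re_inner (𝕜 := ℂ) (ψ t ω)).symm
    have h3 : ∀ α (r : ℝ≥0), ‖M α (Ψ r ω)‖ = normRatio (M α) (ψ r ω) :=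
      fun α r => congrFun (hr α) r
    rw [h2, h1, densityPath, stateExponent]
    simp only [h3]
    rw [mul_left_comm, ← Real.exp_add, neg_mul, neg_add_cancel, Real.exp_zero, mul_one]
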